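/- Let $\Omega\subset\mathbb{R}^2$ be a domain (open and connected), let $\vec F=(F_1,F_2)\in C^1(\Omega;\mathbb{R}^2)$ and $H\in C^0(\Omega)$, and let $u\in C^1(\Omega)$ be a weak solution of $$\operatorname{div}\frac{\nabla u+\vec F}{|\nabla u+\vec F|}=H\quad\text{in }\Omega,$$ that is, for every $\varphi\in C_0^\infty(\Omega)$, $$\int_{S}|\nabla\varphi|+\int_{\Omega\setminus S}\frac{\nabla u+\vec F}{|\nabla u+\vec F|}\cdot\nabla\varphi+\int_\Omega H\varphi\ \ge\ 0,\qquad S=\{p\in\Omega:\ \nabla u+\vec F=0\text{ at }p\}.$$ Suppose that $\Omega$ is nonsingular, i.e. $S=\emptyset$. Put $$D=|\nabla u+\vec F|,\qquad N=\frac{\nabla u+\vec F}{D}=(\cos\theta,\sin\theta),\qquad N^\perp=(\sin\theta,-\cos\theta),\qquad \operatorname{curl}\vec F=(F_2)_x-(F_1)_y .$$ For a continuous vector field $X$ and a function $h$ on $\Omega$, we say that $X(h)$ exists and equals the function $k$ on $\Omega$ if $\frac{d}{dt}h(\gamma(t))=k(\gamma(t))$ along every integral curve $\gamma$ of $X$ in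 $\Omega$. Suppose that $N^\perp(\operatorname{curl}\vec F)$ and $N(H)$ exist and are continuous in $\Omega$. Then $D'=N^\perp(D)$ and $D''=N^\perp(N^\perp(D))$ exist and are continuous in $\Omega$, and throughout $\Omega$ $$D\,D''=2\Bigl(D'-\frac{\operatorname{curl}\vec F}{2}\Bigr)\bigl(D'-\operatorname{curl}\vec F\bigr)+\bigl(N^\perp(\operatorname{curl}\vec F)\bigr)D+\bigl(H^2+N(H)\bigr)D^2 .$$ -/

import Mathlib

open MeasureTheory Topology
open scoped Gradient ContDiff InnerProductSpace

namespace PrescribedMean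

/-- The plane `ℝ²` with its Euclidean norm and Lebesgue measure. -/
abbrev Plane : Type := EuclideanSpace ℝ (Fin 2)

/-- `D = |∇u + F|`. -/
noncomputable def areaElement (u : Plane → ℝ) (F : Plane → Plane) (x : Plane) : ℝ :=
  ‖∇ u x + F x‖

/-- The unit vector field `N = (∇u + F) / |∇u + F|`
(used only at nonsingular points, where `∇u + F ≠ 0`). -/
noncomputable def horizontalNormal (u : Plane → ℝ) (F : Plane → Plane) (x : Plane) : Plane :=
  (areaElement u F x)⁻¹ • (∇ u x + F x)

/-- Rotation `(a, b) ↦ (b, -a)`; it sends `(cos θ, sin θ)` to `(sin θ, -cos θ)`. -/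
noncomputable def perp (v : Plane) : Plane := !₂[v 1, -v 0]

/-- The characteristic direction `N^⊥ = (sin θ, -cos θ)`, where `N = (cos θ, sin θ)`. -/
noncomputable def charDirection (u : Plane → ℝ) (F : Plane → Plane) (x : Plane) : Plane :=
  perp (horizontalNormal u F x)

/-- The singular set of `u` in `Ω`: the points of `Ω` where `∇u + F = 0`. -/
def singularSet (Ω : Set Plane) (u : Plane → ℝ) (F : Plane → Plane) : Set Plane :=
  {x ∈ Ω | ∇ u x + F x = 0}

/-- `curl F = ∂F₂/∂x - ∂F₁/∂y`. -/
noncomputable def curl (F : Plane → Plane) (p : Plane) : ℝ :=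
  (fderiv ℝ F p (EuclideanSpace.single 0 1)) 1 - (fderiv ℝ F p (EuclideanSpace.single 1 1)) 0

/-- `u` is a weak solution of `div ((∇u + F) / |∇u + F|) = H` in `Ω`: for every test function
`φ ∈ C_c^∞(Ω)`, `∫_S |∇φ| + ∫_{Ω \ S} N · ∇φ + ∫_Ω H φ ≥ 0`, with `S` the singular set. -/
def IsWeakSolution (Ω : Set Plane) (u : Plane → ℝ) (F : Plane → Plane) (H : Plane → ℝ) : Prop :=
  ∀ φ : Plane → ℝ, ContDiff ℝ ∞ φ → HasCompactSupport φ → tsupport φ ⊆ Ω →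
    0 ≤ (∫ x in singularSet Ω u F, ‖∇ φ x‖)
      + (∫ x in Ω \ singularSet Ω u F, ⟪horizontalNormal u F x, ∇ φ x⟫_ℝ)
      + ∫ x in Ω, H x * φ x

/-- The derivative `X(h)` of the function `h` along the vector field `X` exists at `p` and equals
`k`: for every integral curve `γ` of `X` with `γ 0 = p`, the function `t ↦ h (γ t)` has derivative
`k` at `0`. The vector fields in use are merely continuous near `p`; by Peano's theorem such a
field has an integral curve through `p`, so that there is at most one such `k`. -/
def HasDerivAlong (X : Plane → Plane) (h : Plane → ℝ) (k : ℝ) (p : Plane) : Prop :=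
  ∀ γ : ℝ → Plane, γ 0 = p → IsIntegralCurveAt γ (fun _ => X) 0 →
    HasDerivAt (fun t => h (γ t)) k 0

end PrescribedMean

open PrescribedMean

/-!
The field `N = (∇u + F) / D` is merely continuous, so the formal computation, which differentiates
the equations `div N = H` and `curl (D N) = curl F`, is not available. It is replaced by an argument
in curvilinear coordinates in which every quantity is as smooth as the computation requires.

*Green's formula.* Testing with `φ` and `-φ` and mollifying, `N^⊥` has curl `-H` in the sense that
its circulation around each rectangle is the integral of `-H` (`hasCirculation_of_weak_divergence`).
The field `D N = ∇u + F` has curl `curl F` in the same sense, since the circulation of `∇u` is zero.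

*Curvature.* For a unit field `V` with continuous curl `c` and an integral curve `γ` of `V`,
`(V ∘ γ)' = c iV` in complex notation. Indeed, by Green's formula and `⟨V, V(γ)⟩ ≤ 1`, the
comparison of `γ` with its translates gives one-sided inequalities, whose direction depends on the
sign of the translation (`HasCirculation.derivAlong_snd`). So the direction of `N` changes at the
rate `-H` along the curves of `N^⊥`.

*Coordinates.* A continuous field with continuous curl has an integrating factor, which satisfies
the expected differential equation along the curves orthogonal to the field
(`HasCirculation.exists_integratingFactor`). For `N^⊥` and `D N` this gives `C¹` coordinates
`(s, t)` near each point, whose inverse `X` satisfies `X_s = g N^⊥`, `X_t = f N`, together with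
`g_t = H f g` and `(D f)_s = c f g`, where `c = curl F` (`exists_isOrthogonalChart`).

*Rotation along the curves of `N`.* Identify the plane with `ℂ`. Then `N(s, t) = e N(s₀, t)` with a
unimodular factor `e` which is differentiable in `t`, because `N(H)` exists; hence
`X(s₁, t) - X(s₀, t) = B N(s₀, t)` with a factor `B` differentiable in `t` and, for
suitable `s₁`, nonzero. The left side is
`C¹`, and therefore so is `N` on the `t`-lines: `N_t = i κ N`. Exchanging derivatives yields
`f_s = g κ` and `κ_s = -f g (H² + N(H))` (`exists_rotation_rate`).

From `(D f)_s = c f g` and these two equations `D` can be differentiated twice in `s`, and as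
`N^⊥` is `g⁻¹ ∂_s`, this yields `D' = c - D κ / f`, and the formula for `D''` follows by eliminating
`κ / f`. The coordinates also provide integral curves of `N^⊥`, which make the derivatives unique,
so that the local results fit together.
-/

namespace PrescribedMean
open Set Filter Metric

/-! ### Calculus in the plane -/

theorem exists_continuous_retraction_closedBall (p : ℝ × ℝ) {r : ℝ} (hr : 0 ≤ r) :
    ∃ ρ : ℝ × ℝ → ℝ × ℝ, Continuous ρ ∧ (∀ q, ρ q ∈ closedBall p r) ∧
      ∀ q ∈ closedBall p r, ρ q = q := by
  have h1 : p.1 - r ≤ p.1 + r := by linarith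
  have h2 : p.2 - r ≤ p.2 + r := by linarith
  have hm : ∀ q : ℝ × ℝ, q ∈ closedBall p r ↔
      q.1 ∈ Icc (p.1 - r) (p.1 + r) ∧ q.2 ∈ Icc (p.2 - r) (p.2 + r) := by
    intro q
    rw [← Real.closedBall_eq_Icc, ← Real.closedBall_eq_Icc, ← mem_prod,
      closedBall_prod_same]
  refine ⟨fun q => (projIcc _ _ h1 q.1, projIcc _ _ h2 q.2), ?_, ?_, ?_⟩
  · exact ((continuous_subtype_val.comp continuous_projIcc).comp continuous_fst).prodMk
      ((continuous_subtype_val.comp continuous_projIcc).comp continuous_snd)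
  · intro q
    rw [hm]
    exact ⟨(projIcc _ _ h1 q.1).2, (projIcc _ _ h2 q.2).2⟩
  · intro q hq
    rw [hm] at hq
    ext
    · simp [projIcc_of_mem h1 hq.1]
    · simp [projIcc_of_mem h2 hq.2]

/-- In the main constructions, functions that are continuous only near a point are replaced by
globally continuous ones, so that all integrals converge and depend continuously on parameters. -/
theorem exists_continuous_extension {E : Type*} [TopologicalSpace E] {f : ℝ × ℝ → E} {p : ℝ × ℝ}
    (hf : ∀ᶠ q in 𝓝 p, ContinuousAt f q) : ∃ g : ℝ × ℝ → E, Continuous g ∧ g =ᶠ[𝓝 p] f := by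
  obtain ⟨r, hr, h⟩ := nhds_basis_closedBall.eventually_iff.1 hf
  obtain ⟨ρ, hρ, hm, hid⟩ := exists_continuous_retraction_closedBall p hr.le
  refine ⟨f ∘ ρ, ?_, ?_⟩
  · exact continuous_iff_continuousAt.2 fun q => (h (hm q)).comp hρ.continuousAt
  · filter_upwards [closedBall_mem_nhds p hr] with q hq
    simp [hid q hq]

theorem exists_continuous_extension_real {E : Type*} [TopologicalSpace E] {f : ℝ → E} {t₀ : ℝ}
    (hf : ∀ᶠ t in 𝓝 t₀, ContinuousAt f t) : ∃ g : ℝ → E, Continuous g ∧ g =ᶠ[𝓝 t₀] f := by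
  have h : ∀ᶠ q : ℝ × ℝ in 𝓝 (t₀, (0 : ℝ)), ContinuousAt (fun q : ℝ × ℝ => f q.1) q := by
    filter_upwards [(continuous_fst.tendsto (t₀, (0 : ℝ))).eventually hf] with q hq
    exact ContinuousAt.comp (f := Prod.fst) (g := f) hq continuousAt_fst
  obtain ⟨g, hg, he⟩ := exists_continuous_extension h
  exact ⟨fun t => g (t, 0), by fun_prop,
    ((Continuous.prodMk_left (0 : ℝ)).tendsto t₀).eventually he⟩

/-- The linear form `a dx + b dy` with vector-valued coefficients. -/
noncomputable def form {E : Type*} [NormedAddCommGroup E] [NormedSpace ℝ E] (a b : E) :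
    ℝ × ℝ →L[ℝ] E :=
  (ContinuousLinearMap.fst ℝ ℝ ℝ).smulRight a + (ContinuousLinearMap.snd ℝ ℝ ℝ).smulRight b

section form

variable {E : Type*} [NormedAddCommGroup E] [NormedSpace ℝ E]

@[simp] theorem form_apply (a b : E) (v : ℝ × ℝ) : form a b v = v.1 • a + v.2 • b := rfl

theorem continuousAt_form {X : Type*} [TopologicalSpace X] {a b : X → E} {x : X}
    (ha : ContinuousAt a x) (hb : ContinuousAt b x) :
    ContinuousAt (fun x => form (a x) (b x)) x := by
  have hL : ∀ L : ℝ × ℝ →L[ℝ] ℝ, Continuous (ContinuousLinearMap.smulRightL ℝ (ℝ × ℝ) E L) :=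
    fun L => ContinuousLinearMap.continuous _
  exact ((hL (ContinuousLinearMap.fst ℝ ℝ ℝ)).continuousAt.comp ha).add
    ((hL (ContinuousLinearMap.snd ℝ ℝ ℝ)).continuousAt.comp hb)

theorem hasStrictFDerivAt_of_partials {f fx fy : ℝ × ℝ → E} {p : ℝ × ℝ}
    (hx : ∀ᶠ q in 𝓝 p, HasDerivAt (fun x => f (x, q.2)) (fx q) q.1)
    (hy : ∀ᶠ q in 𝓝 p, HasDerivAt (fun y => f (q.1, y)) (fy q) q.2)
    (cx : ContinuousAt fx p) (cy : ContinuousAt fy p) :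
    HasStrictFDerivAt f (form (fx p) (fy p)) p := by
  have hc : ∀ {g : ℝ × ℝ → E}, ContinuousAt g p → ContinuousAt
      (↿fun x y : ℝ => ContinuousLinearMap.toSpanSingleton ℝ (g (x, y))) p := fun hg =>
    (ContinuousLinearMap.toSpanSingletonCLE (𝕜 := ℝ) (E := E)).continuous.continuousAt.comp hg
  convert hasStrictFDerivAt_uncurry_coprod (u := p) (f := fun x y => f (x, y))
    (f₁ := fun x y => ContinuousLinearMap.toSpanSingleton ℝ (fx (x, y)))
    (f₂ := fun x y => ContinuousLinearMap.toSpanSingleton ℝ (fy (x, y)))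
    (hx.mono fun q hq => hq.hasFDerivAt) (hy.mono fun q hq => hq.hasFDerivAt) (hc cx) (hc cy)
    using 1
  · rfl
  · exact ContinuousLinearMap.ext fun v => rfl

theorem hasFDerivAt_form_partial_fst {f : ℝ × ℝ → E} {a b : E} {p : ℝ × ℝ}
    (h : HasFDerivAt f (form a b) p) : HasDerivAt (fun x => f (x, p.2)) a p.1 := by
  have := h.comp_hasDerivAt (x := p.1) (f := fun x => (x, p.2))
    ((hasDerivAt_id p.1).prodMk (hasDerivAt_const p.1 p.2))
  simpa using! this

theorem hasFDerivAt_form_partial_snd {f : ℝ × ℝ → E} {a b : E} {p : ℝ × ℝ}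
    (h : HasFDerivAt f (form a b) p) : HasDerivAt (fun y => f (p.1, y)) b p.2 := by
  have := h.comp_hasDerivAt (x := p.2) (f := fun y => (p.1, y))
    ((hasDerivAt_const p.2 p.1).prodMk (hasDerivAt_id p.2))
  simpa using! this

theorem contDiffAt_of_eventually_hasFDerivAt_form {f a b : ℝ × ℝ → E} {p : ℝ × ℝ}
    (h : ∀ᶠ q in 𝓝 p, HasFDerivAt f (form (a q) (b q)) q)
    (ha : ∀ᶠ q in 𝓝 p, ContinuousAt a q) (hb : ∀ᶠ q in 𝓝 p, ContinuousAt b q) :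
    ContDiffAt ℝ 1 f p := by
  rw [contDiffAt_one_iff]
  refine ⟨fun q => form (a q) (b q), _, (h.and (ha.and hb)), fun q hq => ?_, fun q hq => hq.1⟩
  exact (continuousAt_form hq.2.1 hq.2.2).continuousWithinAt

end form

/-- A `C¹` planar map with injective derivative at `p` has a local `C¹` inverse. -/
theorem exists_local_inverse {f : ℝ × ℝ → ℝ × ℝ} {p : ℝ × ℝ} (hf : ContDiffAt ℝ 1 f p)
    {A : ℝ × ℝ →L[ℝ] ℝ × ℝ} (hA : HasFDerivAt f A p) (hinj : ∀ v, A v = 0 → v = 0) :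
    ∃ g : ℝ × ℝ → ℝ × ℝ, ContDiffAt ℝ 1 g (f p) ∧ g (f p) = p ∧ (∀ᶠ q in 𝓝 p, g (f q) = q) ∧
      ∀ᶠ z in 𝓝 (f p), f (g z) = z := by
  have hi : Function.Injective (A : ℝ × ℝ →ₗ[ℝ] ℝ × ℝ) :=
    (injective_iff_map_eq_zero (A : ℝ × ℝ →ₗ[ℝ] ℝ × ℝ)).2 hinj
  let A' : (ℝ × ℝ) ≃L[ℝ] (ℝ × ℝ) :=
    (LinearEquiv.ofInjectiveEndo (A : ℝ × ℝ →ₗ[ℝ] ℝ × ℝ) hi).toContinuousLinearEquiv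
  have hAA : (A' : ℝ × ℝ →L[ℝ] ℝ × ℝ) = A := by rfl
  rw [← hAA] at hA
  have hs := hf.hasStrictFDerivAt' hA one_ne_zero
  exact ⟨hf.localInverse hA one_ne_zero, hf.to_localInverse hA one_ne_zero,
    hf.localInverse_apply_image hA one_ne_zero, hs.eventually_left_inverse,
    hs.eventually_right_inverse⟩

/-- Differentiation under the integral sign for an integrand with a globally continuous extension of
its derivative. -/
theorem hasDerivAt_intervalIntegral_param {E : Type*} [NormedAddCommGroup E] [NormedSpace ℝ E]
    {f f' : ℝ × ℝ → E} {a b t₀ δ : ℝ} (hδ : 0 < δ) (hf : Continuous f) (hf' : Continuous f')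
    (h : ∀ s ∈ uIcc a b, ∀ t ∈ ball t₀ δ, HasDerivAt (fun t => f (s, t)) (f' (s, t)) t) :
    HasDerivAt (fun t => ∫ s in a..b, f (s, t)) (∫ s in a..b, f' (s, t₀)) t₀ := by
  obtain ⟨C, hC⟩ := (isCompact_uIcc.prod (isCompact_closedBall t₀ δ)).exists_bound_of_continuousOn
    (f := f') (s := uIcc a b ×ˢ closedBall t₀ δ) hf'.continuousOn
  refine (intervalIntegral.hasDerivAt_integral_of_dominated_loc_of_deriv_le
    (F := fun t s => f (s, t)) (F' := fun t s => f' (s, t)) (bound := fun _ => C)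
    (s := ball t₀ δ) (ball_mem_nhds t₀ hδ) ?_ ?_ ?_ ?_ ?_ ?_).2
  · exact Eventually.of_forall fun t =>
      (by fun_prop : Continuous fun s => f (s, t)).aestronglyMeasurable
  · exact (by fun_prop : Continuous fun s => f (s, t₀)).intervalIntegrable _ _
  · exact (by fun_prop : Continuous fun s => f' (s, t₀)).aestronglyMeasurable
  · exact Eventually.of_forall fun s hs t ht =>
      hC (s, t) ⟨uIoc_subset_uIcc hs, ball_subset_closedBall ht⟩
  · exact intervalIntegrable_const
  · exact Eventually.of_forall fun s hs t ht => h s (uIoc_subset_uIcc hs) t ht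

/-! ### Derivatives along vector fields -/

/-- The derivative of `h` along the vector field `X` exists at `p` and equals `k`: the notion
`HasDerivAlong` for vector-valued functions on an arbitrary normed space. -/
def DerivAlong {G E : Type*} [NormedAddCommGroup G] [NormedSpace ℝ G] [NormedAddCommGroup E]
    [NormedSpace ℝ E] (X : G → G) (h : G → E) (k : E) (p : G) : Prop :=
  ∀ γ : ℝ → G, γ 0 = p → (∀ᶠ t in 𝓝 0, HasDerivAt γ (X (γ t)) t) →
    HasDerivAt (fun t => h (γ t)) k 0

section DerivAlong

variable {G E : Type*} [NormedAddCommGroup G] [NormedSpace ℝ G] [NormedAddCommGroup E]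
  [NormedSpace ℝ E]

theorem DerivAlong.congr {X X' : G → G} {h h' : G → E} {k : E} {p : G}
    (H : DerivAlong X h k p) (hX : X' =ᶠ[𝓝 p] X) (hh : h' =ᶠ[𝓝 p] h) : DerivAlong X' h' k p := by
  intro γ h0 hγ
  have hc : Tendsto γ (𝓝 0) (𝓝 p) := h0 ▸ hγ.self_of_nhds.continuousAt
  refine (H γ h0 ?_).congr_of_eventuallyEq (hc.eventually hh)
  filter_upwards [hγ, hc.eventually hX] with t ht hXt
  rwa [← hXt]

/-- A curve that follows the field `X` with a continuous nonzero speed `f` is a reparametrized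
integral curve of `X`. -/
theorem exists_integralCurve_reparam {X : G → G} {x : ℝ → G} {f : ℝ → ℝ} {t₀ : ℝ}
    (hf : ∀ᶠ t in 𝓝 t₀, ContinuousAt f t) (hf0 : f t₀ ≠ 0)
    (hx : ∀ᶠ t in 𝓝 t₀, HasDerivAt x (f t • X (x t)) t) :
    ∃ (γ : ℝ → G) (σ : ℝ → ℝ), γ 0 = x t₀ ∧ (∀ᶠ u in 𝓝 0, HasDerivAt γ (X (γ u)) u) ∧
      σ t₀ = 0 ∧ HasDerivAt σ (f t₀) t₀ ∧ ∀ᶠ t in 𝓝 t₀, γ (σ t) = x t := by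
  obtain ⟨g, hg, hgf⟩ := exists_continuous_extension_real hf
  have hg0 : g t₀ ≠ 0 := by rwa [hgf.self_of_nhds]
  set σ : ℝ → ℝ := fun t => ∫ s in t₀..t, g s with hσ
  have hσd : ∀ t, HasStrictDerivAt σ (g t) t := fun t => hg.integral_hasStrictDerivAt t₀ t
  have hσ0 : σ t₀ = 0 := by simp [hσ]
  have hσe := (hσd t₀).hasStrictFDerivAt_equiv hg0
  set τ := (hσd t₀).localInverse σ (g t₀) t₀ hg0 with hτ
  have hτd : HasStrictDerivAt τ (g t₀)⁻¹ (σ t₀) := (hσd t₀).to_localInverse hg0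
  have hl : ∀ᶠ t in 𝓝 t₀, τ (σ t) = t := hσe.eventually_left_inverse
  have hr : ∀ᶠ u in 𝓝 (σ t₀), σ (τ u) = u := hσe.eventually_right_inverse
  have hτ0 : τ (σ t₀) = t₀ := hl.self_of_nhds
  rw [hσ0] at hτd hr hτ0
  have hτc : Tendsto τ (𝓝 0) (𝓝 t₀) := by
    have := hτd.hasDerivAt.continuousAt.tendsto
    rwa [hτ0] at this
  have hτcont : ∀ᶠ u in 𝓝 0, ContinuousAt τ u := by
    have h3 := (hσe.toOpenPartialHomeomorph σ).open_target.mem_nhds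
      hσe.image_mem_toOpenPartialHomeomorph_target
    rw [hσ0] at h3
    filter_upwards [eventually_mem_nhds_iff.2 h3] with u hu
    exact (hσe.toOpenPartialHomeomorph σ).continuousOn_symm.continuousAt hu
  refine ⟨fun u => x (τ u), σ, by simp only [hτ0], ?_, hσ0, ?_, ?_⟩
  · filter_upwards [hτcont, eventually_eventually_nhds.2 hr, hτc.eventually hx, hτc.eventually hgf,
      hτc.eventually (hg.continuousAt.eventually_ne hg0)] with u hu1 hu2 hu3 hu4 hu5
    have h1 : HasDerivAt τ (g (τ u))⁻¹ u :=
      HasDerivAt.of_local_left_inverse hu1 (hσd (τ u)).hasDerivAt hu5 hu2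
    have h2 := hu3.scomp u h1
    rw [hu4, smul_smul, inv_mul_cancel₀ (by rwa [← hu4]), one_smul] at h2
    exact h2
  · rw [← hgf.self_of_nhds]
    exact (hσd t₀).hasDerivAt
  · filter_upwards [hl] with t ht
    simp only [ht]

theorem DerivAlong.hasDerivAt_reparam {X : G → G} {h : G → E} {k : E} {x : ℝ → G} {f : ℝ → ℝ}
    {t₀ : ℝ} (H : DerivAlong X h k (x t₀)) (hf : ∀ᶠ t in 𝓝 t₀, ContinuousAt f t)
    (hf0 : f t₀ ≠ 0) (hx : ∀ᶠ t in 𝓝 t₀, HasDerivAt x (f t • X (x t)) t) :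
    HasDerivAt (fun t => h (x t)) (f t₀ • k) t₀ := by
  obtain ⟨γ, σ, hγ0, hγ, hσ0, hσ, hγσ⟩ := exists_integralCurve_reparam hf hf0 hx
  refine ((H γ hγ0 hγ).scomp_of_eq t₀ hσ hσ0.symm).congr_of_eventuallyEq ?_
  filter_upwards [hγσ] with t ht
  simp [ht]

theorem DerivAlong.unique {X : G → G} {h : G → E} {k k' : E} {p : G} (H : DerivAlong X h k p)
    (H' : DerivAlong X h k' p) {γ : ℝ → G} (h0 : γ 0 = p)
    (hγ : ∀ᶠ t in 𝓝 0, HasDerivAt γ (X (γ t)) t) : k = k' :=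
  (H γ h0 hγ).unique (H' γ h0 hγ)

end DerivAlong

/-! ### A planar flow that is differentiable in its initial value -/

theorem hasDerivAt_of_eventually_eq_mul {f g : ℝ → ℝ} {x : ℝ}
    (h : ∀ᶠ y in 𝓝 x, f y - f x = (y - x) * g y) (hg : ContinuousAt g x) :
    HasDerivAt f (g x) x := by
  rw [hasDerivAt_iff_tendsto_slope]
  refine (hg.tendsto.mono_left nhdsWithin_le_nhds).congr' ?_
  filter_upwards [h.filter_mono nhdsWithin_le_nhds, self_mem_nhdsWithin] with y hy hne
  rw [slope_def_field, hy, mul_div_cancel_left₀ _ (sub_ne_zero.2 hne)]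

/-- Hadamard's lemma in the second variable. -/
theorem sub_eq_mul_integral_deriv {Q k : ℝ × ℝ → ℝ} (hk : Continuous k) {x w w' : ℝ}
    (h : ∀ v ∈ uIcc w w', HasDerivAt (fun v => Q (x, v)) (k (x, v)) v) :
    Q (x, w') - Q (x, w) = (w' - w) * ∫ θ in (0 : ℝ)..1, k (x, w + θ * (w' - w)) := by
  have h1 : ∀ θ ∈ uIcc (0 : ℝ) 1, HasDerivAt (fun θ => Q (x, w + θ * (w' - w)))
      (k (x, w + θ * (w' - w)) * (w' - w)) θ := by
    intro θ hθ
    rw [uIcc_of_le zero_le_one] at hθ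
    have hm : w + θ * (w' - w) ∈ uIcc w w' := by
      rw [← segment_eq_uIcc]
      exact ⟨1 - θ, θ, by linarith [hθ.2], hθ.1, by ring, by simp only [smul_eq_mul]; ring⟩
    have h2 : HasDerivAt (fun θ => w + θ * (w' - w)) (w' - w) θ := by
      simpa using ((hasDerivAt_id θ).mul_const (w' - w)).const_add w
    exact (h _ hm).comp θ h2
  have h2 := intervalIntegral.integral_eq_sub_of_hasDerivAt h1
    ((by fun_prop : Continuous fun θ => k (x, w + θ * (w' - w)) * (w' - w)).intervalIntegrable _ _)
  rw [intervalIntegral.integral_mul_const] at h2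
  rw [mul_comm, h2]
  congr 2 <;> simp

/-- A scalar equation `w' = Q(x, w)` whose right side is merely continuous in `x` but `C¹` in `w`
has a local flow, differentiable in the initial value, with the usual variational formula. -/
theorem exists_flow {Q k : ℝ × ℝ → ℝ} (hQ : Continuous Q) (hk : Continuous k) {x₀ R : ℝ}
    (hR : 0 < R)
    (hd : ∀ q ∈ ball (x₀, (0 : ℝ)) R, HasDerivAt (fun w => Q (q.1, w)) (k q) q.2) :
    ∃ (W : ℝ × ℝ → ℝ) (δ : ℝ), Continuous W ∧ 0 < δ ∧ ∀ q ∈ ball (x₀, (0 : ℝ)) δ,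
      W (x₀, q.2) = q.2 ∧ (q.1, W q) ∈ ball (x₀, (0 : ℝ)) R ∧
      HasDerivAt (fun x => W (x, q.2)) (Q (q.1, W q)) q.1 ∧
      HasDerivAt (fun η => W (q.1, η)) (Real.exp (∫ t in x₀..q.1, k (t, W (t, q.2)))) q.2 := by
  have hball : ∀ (δ : ℝ) (q : ℝ × ℝ), q ∈ ball (x₀, (0 : ℝ)) δ ↔ |q.1 - x₀| < δ ∧ |q.2| < δ := by
    intro δ q
    rw [← ball_prod_same, mem_prod, mem_ball, mem_ball, Real.dist_eq, Real.dist_eq, sub_zero]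
  -- bounds for `Q` and `k` on a compact box
  have hcomp : IsCompact (Icc (x₀ - R / 2) (x₀ + R / 2) ×ˢ closedBall (0 : ℝ) (R / 2)) :=
    isCompact_Icc.prod (isCompact_closedBall _ _)
  obtain ⟨L, hL⟩ := hcomp.exists_bound_of_continuousOn hQ.continuousOn
  obtain ⟨K, hK⟩ := hcomp.exists_bound_of_continuousOn hk.continuousOn
  set L' : ℝ := max L 0 + 1
  have hL' : 0 < L' := by positivity
  set τ : ℝ := min (R / 2) (R / 4 / L') with hτ
  have hτ0 : 0 < τ := by positivity
  have hτR : τ ≤ R / 2 := min_le_left _ _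
  have hτL : L' * τ ≤ R / 4 := by
    calc L' * τ ≤ L' * (R / 4 / L') := by gcongr; exact min_le_right _ _
      _ = R / 4 := by field_simp
  have hx₀ : x₀ ∈ Icc (x₀ - τ) (x₀ + τ) := ⟨by linarith, by linarith⟩
  have hbox : ∀ t ∈ Icc (x₀ - τ) (x₀ + τ), ∀ w ∈ closedBall (0 : ℝ) (R / 2),
      (t, w) ∈ Icc (x₀ - R / 2) (x₀ + R / 2) ×ˢ closedBall (0 : ℝ) (R / 2) :=
    fun t ht w hw => ⟨⟨by linarith [ht.1], by linarith [ht.2]⟩, hw⟩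
  have hPL : IsPicardLindelof (fun x w => Q (x, w)) (⟨x₀, hx₀⟩ : Icc (x₀ - τ) (x₀ + τ)) (0 : ℝ)
      (R / 2).toNNReal (R / 4).toNNReal L'.toNNReal K.toNNReal := by
    have hRR : ((R / 2).toNNReal : ℝ) = R / 2 := Real.coe_toNNReal _ (by positivity)
    have hRR4 : ((R / 4).toNNReal : ℝ) = R / 4 := Real.coe_toNNReal _ (by positivity)
    have hLL : (L'.toNNReal : ℝ) = L' := Real.coe_toNNReal _ (by positivity)
    refine ⟨fun t ht => ?_, fun w hw => by fun_prop, fun t ht w hw => ?_, ?_⟩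
    · rw [hRR]
      refine (convex_closedBall (0 : ℝ) (R / 2)).lipschitzOnWith_of_nnnorm_hasDerivWithin_le
        (f' := fun w => k (t, w)) (fun w hw => ?_) (fun w hw => ?_)
      · refine (hd (t, w) ((hball _ _).2 ⟨?_, ?_⟩)).hasDerivWithinAt
        · rw [abs_lt]; constructor <;> linarith [ht.1, ht.2]
        · have : |w| ≤ R / 2 := by simpa using hw
          linarith
      · rw [← NNReal.coe_le_coe, coe_nnnorm]
        exact (hK _ (hbox t ht w hw)).trans (Real.le_coe_toNNReal K)
    · rw [hRR] at hw
      rw [hLL]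
      exact (hL _ (hbox t ht w hw)).trans (by simp only [L']; linarith [le_max_left L 0])
    · rw [hRR, hRR4, hLL]
      simp only [add_sub_cancel_left, sub_sub_cancel, max_self]
      linarith
  obtain ⟨α, hα, hαc⟩ := hPL.exists_forall_mem_closedBall_eq_hasDerivWithinAt_continuousOn
  rw [Real.coe_toNNReal _ (by positivity)] at hα hαc
  -- a globally continuous version of the flow
  set r₁ : ℝ := min τ (R / 4)
  have hr₁ : 0 < r₁ := by positivity
  obtain ⟨ρ, hρ, hρm, hρid⟩ := exists_continuous_retraction_closedBall (x₀, (0 : ℝ)) hr₁.le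
  have hcb : ∀ q ∈ closedBall (x₀, (0 : ℝ)) r₁,
      q.2 ∈ closedBall (0 : ℝ) (R / 4) ∧ q.1 ∈ Icc (x₀ - τ) (x₀ + τ) := by
    intro q hq
    rw [← closedBall_prod_same, mem_prod] at hq
    refine ⟨closedBall_subset_closedBall (min_le_right _ _) hq.2, ?_⟩
    rw [← Real.closedBall_eq_Icc]
    exact closedBall_subset_closedBall (min_le_left _ _) hq.1
  set W : ℝ × ℝ → ℝ := fun q => α ((ρ q).2, (ρ q).1) with hW
  have hWc : Continuous W := by
    refine hαc.comp_continuous (by fun_prop) fun q => ?_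
    exact hcb _ (hρm q)
  have hWα : ∀ q ∈ ball (x₀, (0 : ℝ)) r₁, W q = α (q.2, q.1) := fun q hq => by
    simp only [hW, hρid q (ball_subset_closedBall hq)]
  have hW0 : ∀ η, |η| < r₁ → W (x₀, η) = η := by
    intro η hη
    have hm : (x₀, η) ∈ ball (x₀, (0 : ℝ)) r₁ := (hball _ _).2 ⟨by simpa using hr₁, hη⟩
    rw [hWα _ hm]
    exact (hα η (hcb _ (ball_subset_closedBall hm)).1).1
  have hWx : ∀ q ∈ ball (x₀, (0 : ℝ)) r₁,
      HasDerivAt (fun x => W (x, q.2)) (Q (q.1, W q)) q.1 := by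
    intro q hq
    have hq' := hcb q (ball_subset_closedBall hq)
    have hlt := (hball _ _).1 hq
    have hlt' : |q.1 - x₀| < τ := hlt.1.trans_le (min_le_left _ _)
    have hnear : Icc (x₀ - τ) (x₀ + τ) ∈ 𝓝 q.1 :=
      Icc_mem_nhds (by linarith [(abs_lt.1 hlt').1]) (by linarith [(abs_lt.1 hlt').2])
    have h1 := ((hα q.2 hq'.1).2 q.1 hq'.2).hasDerivAt hnear
    rw [hWα q hq]
    refine h1.congr_of_eventuallyEq ?_
    have : ∀ᶠ x in 𝓝 q.1, (x, q.2) ∈ ball (x₀, (0 : ℝ)) r₁ :=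
      (Continuous.prodMk_left q.2).continuousAt.preimage_mem_nhds (isOpen_ball.mem_nhds hq)
    filter_upwards [this] with x hx
    exact hWα _ hx
  -- shrink so that the solutions stay in the domain where `Q` is differentiable
  have hWR : ∀ᶠ q in 𝓝 (x₀, (0 : ℝ)), |W q| < R := by
    have h0 : |W (x₀, (0 : ℝ))| < R := by rw [hW0 0 (by simpa using hr₁)]; simpa using hR
    exact (hWc.abs.tendsto _).eventually (gt_mem_nhds h0)
  obtain ⟨r₂, hr₂, h2⟩ := Metric.eventually_nhds_iff_ball.1 hWR
  set δ := min r₁ r₂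
  have hδ : 0 < δ := by positivity
  have hδR : δ ≤ R := (min_le_left _ _).trans ((min_le_left _ _).trans (hτR.trans (by linarith)))
  refine ⟨W, δ, hWc, hδ, fun q hq => ?_⟩
  have hstay : ∀ q ∈ ball (x₀, (0 : ℝ)) δ, (q.1, W q) ∈ ball (x₀, (0 : ℝ)) R := fun q hq =>
    (hball _ _).2 ⟨((hball _ _).1 hq).1.trans_le hδR,
      h2 q (ball_subset_ball (min_le_right _ _) hq)⟩
  have hq1 := (hball _ _).1 hq
  refine ⟨hW0 q.2 (hq1.2.trans_le (min_le_left _ _)), hstay q hq,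
    hWx q (ball_subset_ball (min_le_left _ _) hq), ?_⟩
  set κ : ℝ → ℝ → ℝ → ℝ := fun η η' x =>
    ∫ θ in (0 : ℝ)..1, k (x, W (x, η) + θ * (W (x, η') - W (x, η))) with hκ
  have hκc : Continuous fun z : ℝ × ℝ × ℝ => κ z.1 z.2.1 z.2.2 := by
    simp only [hκ]
    refine intervalIntegral.continuous_parametric_intervalIntegral_of_continuous' ?_ _ _
    simp only [Function.uncurry_def]
    fun_prop
  -- the difference of two solutions solves a linear equation
  have key : ∀ η', |η'| < δ → W (q.1, η') - W (q.1, q.2) =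
      (η' - q.2) * Real.exp (∫ t in x₀..q.1, κ q.2 η' t) := by
    intro η' hη'
    have hκx : Continuous (κ q.2 η') := hκc.comp (by fun_prop : Continuous fun x => (q.2, η', x))
    have hder : ∀ x ∈ ball x₀ δ, HasDerivAt (fun x => (W (x, η') - W (x, q.2)) *
        Real.exp (-∫ t in x₀..x, κ q.2 η' t)) 0 x := by
      intro x hx
      rw [mem_ball, Real.dist_eq] at hx
      have hm1 : (x, η') ∈ ball (x₀, (0 : ℝ)) δ := (hball _ _).2 ⟨hx, hη'⟩
      have hm2 : (x, q.2) ∈ ball (x₀, (0 : ℝ)) δ := (hball _ _).2 ⟨hx, hq1.2⟩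
      have d1 := (hWx (x, η') (ball_subset_ball (min_le_left _ _) hm1)).sub
        (hWx (x, q.2) (ball_subset_ball (min_le_left _ _) hm2))
      have d2 := (hκx.integral_hasStrictDerivAt x₀ x).hasDerivAt.neg.exp
      have e := sub_eq_mul_integral_deriv (Q := Q) hk (x := x) (w := W (x, q.2)) (w' := W (x, η'))
        fun v hv => hd (x, v) ((hball _ _).2 ⟨hx.trans_le hδR, by
          have ha := ((hball _ _).1 (hstay _ hm1)).2
          have hb := ((hball _ _).1 (hstay _ hm2)).2
          have := (convex_ball (0 : ℝ) R).ordConnected.uIcc_subset (x := W (x, q.2))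
            (by simpa using hb) (y := W (x, η')) (by simpa using ha) hv
          simpa using this⟩)
      refine (d1.mul d2).congr_deriv ?_
      simp only [Pi.sub_apply, Pi.neg_apply]
      rw [e]
      simp only [hκ]
      ring
    have hconst := isOpen_ball.is_const_of_deriv_eq_zero (convex_ball x₀ δ).isPreconnected
      (fun x hx => (hder x hx).differentiableAt.differentiableWithinAt)
      (fun x hx => (hder x hx).deriv) (show q.1 ∈ ball x₀ δ by
        rw [mem_ball, Real.dist_eq]; exact hq1.1) (mem_ball_self hδ)
    simp only [intervalIntegral.integral_same, neg_zero, Real.exp_zero, mul_one] at hconst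
    rw [hW0 _ (hη'.trans_le (min_le_left _ _)), hW0 _ (hq1.2.trans_le (min_le_left _ _)),
      Real.exp_neg] at hconst
    rw [← hconst, mul_assoc, inv_mul_cancel₀ (Real.exp_ne_zero _), mul_one]
  have hI : Continuous fun η' => Real.exp (∫ t in x₀..q.1, κ q.2 η' t) := by
    refine Real.continuous_exp.comp
      (intervalIntegral.continuous_parametric_intervalIntegral_of_continuous' ?_ _ _)
    exact hκc.comp (by fun_prop : Continuous fun z : ℝ × ℝ => (q.2, z.1, z.2))
  have hfin := hasDerivAt_of_eventually_eq_mul (f := fun η => W (q.1, η)) (x := q.2)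
    (g := fun η' => Real.exp (∫ t in x₀..q.1, κ q.2 η' t)) ?_ hI.continuousAt
  · convert hfin using 5 with t
    simp [hκ]
  · have : ∀ᶠ η' in 𝓝 q.2, |η'| < δ := continuous_abs.continuousAt.eventually (gt_mem_nhds hq1.2)
    filter_upwards [this] with η' hη' using key η' hη'

/-! ### Continuous vector fields with continuous curl -/

/-- The field `(a, b)` has curl `c` in `S` in the integrated sense of Green's formula: the
circulation around each rectangle contained in `S` is the integral of `c` over the rectangle. No
differentiability of `a` and `b` is required. -/
def HasCirculation (a b c : ℝ × ℝ → ℝ) (S : Set (ℝ × ℝ)) : Prop :=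
  ∀ x₁ x₂ y₁ y₂ : ℝ, uIcc x₁ x₂ ×ˢ uIcc y₁ y₂ ⊆ S →
    (∫ x in x₁..x₂, a (x, y₁)) + (∫ y in y₁..y₂, b (x₂, y)) - (∫ x in x₁..x₂, a (x, y₂))
      - (∫ y in y₁..y₂, b (x₁, y)) = ∫ x in x₁..x₂, ∫ y in y₁..y₂, c (x, y)

theorem HasCirculation.swap {a b c : ℝ × ℝ → ℝ} {S : Set (ℝ × ℝ)} (hc : Continuous c)
    (h : HasCirculation a b c S) :
    HasCirculation (b ∘ Prod.swap) (a ∘ Prod.swap) (fun q => -c q.swap) (Prod.swap ⁻¹' S) := by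
  intro x₁ x₂ y₁ y₂ hS
  have h1 := h y₁ y₂ x₁ x₂ (by
    rintro ⟨x, y⟩ ⟨hx, hy⟩
    exact hS (show (y, x) ∈ uIcc x₁ x₂ ×ˢ uIcc y₁ y₂ from ⟨hy, hx⟩))
  have h2 : (∫ x in y₁..y₂, ∫ y in x₁..x₂, c (x, y)) = ∫ y in x₁..x₂, ∫ x in y₁..y₂, c (x, y) := by
    refine intervalIntegral_intervalIntegral_swap ?_
    have hcomp : IsCompact (uIcc y₁ y₂ ×ˢ uIcc x₁ x₂) := isCompact_uIcc.prod isCompact_uIcc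
    exact (hc.continuousOn.integrableOn_compact hcomp).mono_set
      (prod_mono uIoc_subset_uIcc uIoc_subset_uIcc)
  simp only [Function.comp, Prod.swap_prod_mk, intervalIntegral.integral_neg]
  rw [← h2, ← h1]
  ring

/-- The primitive of `c` in the second variable, vanishing on the horizontal line through `p`. -/
noncomputable def vertPrimitive (c : ℝ × ℝ → ℝ) (p q : ℝ × ℝ) : ℝ := ∫ t in p.2..q.2, c (q.1, t)

/-- The integral of `a dx + b dy` along the path that leads from `p` to `q` first horizontally,
then vertically. -/
noncomputable def pathPotential (a b : ℝ × ℝ → ℝ) (p q : ℝ × ℝ) : ℝ :=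
  (∫ t in p.1..q.1, a (t, p.2)) + ∫ t in p.2..q.2, b (q.1, t)

section potential

variable {a b c : ℝ × ℝ → ℝ} {p : ℝ × ℝ}

theorem continuous_vertPrimitive (hc : Continuous c) : Continuous (vertPrimitive c p) := by
  unfold vertPrimitive
  refine intervalIntegral.continuous_parametric_intervalIntegral_of_continuous ?_ continuous_snd
  simp only [Function.uncurry_def]
  fun_prop

theorem continuous_pathPotential (ha : Continuous a) (hb : Continuous b) :
    Continuous (pathPotential a b p) := by
  unfold pathPotential
  refine Continuous.add ?_ (continuous_vertPrimitive hb)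
  refine intervalIntegral.continuous_parametric_intervalIntegral_of_continuous
    (f := fun _ t => a (t, p.2)) ?_ continuous_fst
  simp only [Function.uncurry_def]
  fun_prop

theorem hasDerivAt_vertPrimitive_snd (hc : Continuous c) (q : ℝ × ℝ) :
    HasDerivAt (fun y => vertPrimitive c p (q.1, y)) (c q) q.2 :=
  ((by fun_prop : Continuous fun t => c (q.1, t)).integral_hasStrictDerivAt p.2 q.2).hasDerivAt

theorem hasDerivAt_pathPotential_snd (hb : Continuous b) (q : ℝ × ℝ) :
    HasDerivAt (fun y => pathPotential a b p (q.1, y)) (b q) q.2 :=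
  (hasDerivAt_vertPrimitive_snd hb q).const_add (∫ t in p.1..q.1, a (t, p.2))

theorem uIcc_prod_uIcc_subset_ball {r : ℝ} {q q' : ℝ × ℝ} (hq : q ∈ ball p r)
    (hq' : q' ∈ ball p r) : uIcc q.1 q'.1 ×ˢ uIcc q.2 q'.2 ⊆ ball p r := by
  rw [← ball_prod_same, mem_prod] at hq hq'
  rw [← ball_prod_same]
  exact prod_mono ((convex_ball _ _).ordConnected.uIcc_subset hq.1 hq'.1)
    ((convex_ball _ _).ordConnected.uIcc_subset hq.2 hq'.2)

/-- By Green's formula the horizontal derivative of the path potential is `a`, up to the primitive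
of the curl. -/
theorem HasCirculation.hasDerivAt_pathPotential_fst (ha : Continuous a)
    (hc : Continuous c) {r : ℝ} (h : HasCirculation a b c (ball p r)) {q : ℝ × ℝ}
    (hq : q ∈ ball p r) :
    HasDerivAt (fun x => pathPotential a b p (x, q.2)) (a q + vertPrimitive c p q) q.1 := by
  have hr : 0 < r := pos_of_mem_ball hq
  have h1 : ∀ᶠ x in 𝓝 q.1, pathPotential a b p (x, q.2) =
      (∫ t in p.1..x, (a (t, q.2) + vertPrimitive c p (t, q.2))) + ∫ t in p.2..q.2, b (p.1, t) := by
    have : ∀ᶠ x in 𝓝 q.1, (x, q.2) ∈ ball p r :=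
      (Continuous.prodMk_left q.2).continuousAt.preimage_mem_nhds (isOpen_ball.mem_nhds hq)
    filter_upwards [this] with x hx
    have e := h p.1 x p.2 q.2 (uIcc_prod_uIcc_subset_ball (mem_ball_self hr) hx)
    rw [intervalIntegral.integral_add]
    · simp only [pathPotential, vertPrimitive]
      linarith
    · exact (by fun_prop : Continuous fun t => a (t, q.2)).intervalIntegrable _ _
    · exact ((continuous_vertPrimitive hc).comp
        (by fun_prop : Continuous fun t : ℝ => (t, q.2))).intervalIntegrable _ _
  have h2 : Continuous fun t => a (t, q.2) + vertPrimitive c p (t, q.2) :=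
    (by fun_prop : Continuous fun t => a (t, q.2)).add ((continuous_vertPrimitive hc).comp
        (by fun_prop : Continuous fun t : ℝ => (t, q.2)))
  exact ((h2.integral_hasStrictDerivAt p.1 q.1).hasDerivAt.add_const _).congr_of_eventuallyEq h1

theorem HasCirculation.hasFDerivAt_pathPotential (ha : Continuous a) (hb : Continuous b)
    (hc : Continuous c) {r : ℝ} (h : HasCirculation a b c (ball p r)) {q : ℝ × ℝ}
    (hq : q ∈ ball p r) :
    HasFDerivAt (pathPotential a b p) (form (a q + vertPrimitive c p q) (b q)) q := by
  refine (hasStrictFDerivAt_of_partials (fx := fun q => a q + vertPrimitive c p q) (fy := b) ?_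
    (Eventually.of_forall (hasDerivAt_pathPotential_snd hb)) ?_ hb.continuousAt).hasFDerivAt
  · filter_upwards [isOpen_ball.mem_nhds hq] with q' hq'
    exact h.hasDerivAt_pathPotential_fst ha hc hq'
  · exact (ha.add (continuous_vertPrimitive hc)).continuousAt

/-! ### Unit fields: the curl is the curvature of the integral curves -/

theorem integral_eq_mul_integral_zero_one (b : ℝ × ℝ → ℝ) (x y ε : ℝ) :
    (∫ t in y..y + ε, b (x, t)) = ε * ∫ t in (0 : ℝ)..1, b (x, y + ε * t) := by
  have := intervalIntegral.smul_integral_comp_add_mul (a := 0) (b := 1) (fun t => b (x, t)) ε y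
  simp only [mul_zero, add_zero, mul_one, smul_eq_mul] at this
  exact this.symm

/-- Second component of the curvature equation for integral curves of a unit field with continuous
curl. The integral curve is compared with its vertical translates: as `⟨V(q), V(γ)⟩ ≤ 1`, the
potential difference between `γ` and its translate by `ε` is controlled from one side, and the side
depends on the sign of `ε`. -/
theorem HasCirculation.derivAlong_snd (ha : Continuous a) (hb : Continuous b) (hc : Continuous c)
    {r : ℝ} (h : HasCirculation a b c (ball p r))
    (hunit : ∀ q ∈ ball p r, a q ^ 2 + b q ^ 2 = 1) {q : ℝ × ℝ} (hq : q ∈ ball p r) :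
    DerivAlong (fun q => (a q, b q)) b (c q * a q) q := by
  intro γ h0 hγ
  have hγc : ContinuousAt γ 0 := hγ.self_of_nhds.continuousAt
  -- a square around `q` and a time interval on which all the translates stay in the ball
  obtain ⟨ε₀, hε₀, hball⟩ := Metric.isOpen_iff.1 isOpen_ball q hq
  have hnear : ∀ᶠ t in 𝓝 0, γ t ∈ ball q (ε₀ / 2) :=
    hγc.preimage_mem_nhds (h0 ▸ ball_mem_nhds _ (by positivity))
  obtain ⟨δ, hδ, hδγ⟩ := nhds_basis_closedBall.eventually_iff.1 (hγ.and hnear)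
  -- `g` is `γ`, clamped in time in order to be continuous everywhere
  set g : ℝ → ℝ × ℝ := fun t => γ (projIcc (-δ) δ (by linarith) t) with hg
  have hIcc : ∀ t : ℝ, t ∈ closedBall (0 : ℝ) δ ↔ t ∈ Icc (-δ) δ := by
    intro t; rw [Real.closedBall_eq_Icc]; simp
  have hgc : Continuous g := by
    refine ContinuousOn.comp_continuous (s := Icc (-δ) δ) (fun t ht => ?_)
      (continuous_subtype_val.comp continuous_projIcc) fun t => (projIcc (-δ) δ _ t).2
    exact (hδγ ((hIcc t).2 ht)).1.continuousAt.continuousWithinAt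
  have hgγ : ∀ t ∈ Icc (-δ) δ, g t = γ t := fun t ht => by simp [hg, projIcc_of_mem _ ht]
  -- `A ε t` and `B ε t`: averages of `c` and `b` over the segment from `γ t` to its translate
  set A : ℝ → ℝ → ℝ := fun ε t => ∫ θ in (0 : ℝ)..1, c ((g t).1, (g t).2 + ε * θ) with hA
  set B : ℝ → ℝ → ℝ := fun ε t => ∫ θ in (0 : ℝ)..1, b ((g t).1, (g t).2 + ε * θ) with hB
  have hAc : Continuous fun z : ℝ × ℝ => A z.1 z.2 := by
    refine intervalIntegral.continuous_parametric_intervalIntegral_of_continuous' ?_ _ _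
    simp only [Function.uncurry_def]
    fun_prop
  have hBc : Continuous fun z : ℝ × ℝ => B z.1 z.2 := by
    refine intervalIntegral.continuous_parametric_intervalIntegral_of_continuous' ?_ _ _
    simp only [Function.uncurry_def]
    fun_prop
  have hmem : ∀ t ∈ Icc (-δ) δ, ∀ ε, |ε| < ε₀ / 2 → (g t + (0, ε)) ∈ ball p r := by
    intro t ht ε hε
    apply hball
    have h1 := (hδγ ((hIcc t).2 ht)).2
    rw [← hgγ t ht, mem_ball, dist_eq_norm] at h1
    rw [mem_ball, dist_eq_norm]
    calc ‖g t + (0, ε) - q‖ = ‖(g t - q) + (0, ε)‖ := by congr 1; abel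
      _ ≤ ‖g t - q‖ + ‖((0 : ℝ), ε)‖ := norm_add_le _ _
      _ = ‖g t - q‖ + |ε| := by simp
      _ < ε₀ := by linarith
  -- the one-sided differential inequality for the potential difference `ε * B ε`
  have hder : ∀ ε, |ε| < ε₀ / 2 → ∀ t ∈ Ioo (-δ) δ,
      ∃ e ≤ 0, HasDerivAt (fun t => ε * B ε t - ∫ s in (0 : ℝ)..t, ε * A ε s * a (g s)) e t := by
    intro ε hε t ht
    have ht' : t ∈ Icc (-δ) δ := Ioo_subset_Icc_self ht
    have hg' : HasDerivAt g (a (g t), b (g t)) t := by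
      have h1 := (hδγ ((hIcc t).2 ht')).1
      rw [← hgγ t ht'] at h1
      refine h1.congr_of_eventuallyEq ?_
      filter_upwards [Icc_mem_nhds ht.1 ht.2] with s hs using hgγ s hs
    have d1 : HasDerivAt (fun t => pathPotential a b p (g t + (0, ε)))
        (a (g t) * (a (g t + (0, ε)) + vertPrimitive c p (g t + (0, ε)))
          + b (g t) * b (g t + (0, ε))) t := by
      have := (h.hasFDerivAt_pathPotential ha hb hc (hmem t ht' ε hε)).comp_hasDerivAt t
        (hg'.add_const ((0 : ℝ), ε))
      simpa using! this
    have d2 : HasDerivAt (fun t => pathPotential a b p (g t))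
        (a (g t) * (a (g t) + vertPrimitive c p (g t)) + b (g t) * b (g t)) t := by
      have hm := hmem t ht' 0 (by simpa using hε₀)
      rw [Prod.mk_zero_zero, add_zero] at hm
      have := (h.hasFDerivAt_pathPotential ha hb hc hm).comp_hasDerivAt t hg'
      simpa using! this
    have hcont : Continuous fun s => ε * A ε s * a (g s) :=
      (continuous_const.mul (hAc.comp (by fun_prop : Continuous fun s : ℝ => (ε, s)))).mul
        (ha.comp hgc)
    have d3 := (hcont.integral_hasStrictDerivAt 0 t).hasDerivAt
    have hpot : ∀ t,
        ε * B ε t = pathPotential a b p (g t + (0, ε)) - pathPotential a b p (g t) := by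
      intro t
      rw [hB, ← integral_eq_mul_integral_zero_one b]
      simp only [pathPotential, Prod.fst_add, Prod.snd_add, add_zero]
      rw [add_sub_add_left_eq_sub, intervalIntegral.integral_interval_sub_left]
      · exact (by fun_prop : Continuous fun s => b ((g t).1, s)).intervalIntegrable _ _
      · exact (by fun_prop : Continuous fun s => b ((g t).1, s)).intervalIntegrable _ _
    have hprim : ε * A ε t = vertPrimitive c p (g t + (0, ε)) - vertPrimitive c p (g t) := by
      rw [hA, ← integral_eq_mul_integral_zero_one c]
      simp only [vertPrimitive, Prod.fst_add, Prod.snd_add, add_zero]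
      rw [intervalIntegral.integral_interval_sub_left]
      · exact (by fun_prop : Continuous fun s => c ((g t).1, s)).intervalIntegrable _ _
      · exact (by fun_prop : Continuous fun s => c ((g t).1, s)).intervalIntegrable _ _
    refine ⟨_, ?_, ((d1.sub d2).sub d3).congr_of_eventuallyEq
      (Eventually.of_forall fun t => by simp [hpot])⟩
    have hm := hmem t ht' 0 (by simpa using hε₀)
    rw [Prod.mk_zero_zero, add_zero] at hm
    have u1 := hunit _ hm
    have u2 := hunit _ (hmem t ht' ε hε)
    rw [hprim]
    nlinarith [sq_nonneg (a (g t) - a (g t + (0, ε))), sq_nonneg (b (g t) - b (g t + (0, ε)))]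
  set G : ℝ → ℝ → ℝ := fun ε t => B ε t - ∫ s in (0 : ℝ)..t, A ε s * a (g s) with hG
  have hGe : ∀ ε t, ε * G ε t = ε * B ε t - ∫ s in (0 : ℝ)..t, ε * A ε s * a (g s) := by
    intro ε t
    simp only [hG, mul_sub, mul_assoc, intervalIntegral.integral_const_mul]
  have hanti : ∀ ε, |ε| < ε₀ / 2 → AntitoneOn (fun t => ε * G ε t) (Ioo (-δ) δ) := by
    intro ε hε
    simp only [hGe]
    choose! e he hed using hder ε hε
    refine antitoneOn_of_deriv_nonpos (convex_Ioo _ _)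
      (fun t ht => (hed t ht).continuousAt.continuousWithinAt)
      (fun t ht => ?_) fun t ht => ?_
    · rw [interior_Ioo] at ht
      exact (hed t ht).differentiableAt.differentiableWithinAt
    · rw [interior_Ioo] at ht
      rw [(hed t ht).deriv]; exact he t ht
  have hGc : ∀ t, Continuous fun ε => G ε t := by
    intro t
    refine (hBc.comp (by fun_prop : Continuous fun ε : ℝ => (ε, t))).sub ?_
    refine intervalIntegral.continuous_parametric_intervalIntegral_of_continuous' ?_ _ _
    exact hAc.mul (ha.comp (hgc.comp continuous_snd))
  -- letting `ε → 0` from both sides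
  have hle : ∀ t₁ ∈ Ioo (-δ) δ, ∀ t₂ ∈ Ioo (-δ) δ, t₁ ≤ t₂ → G 0 t₁ = G 0 t₂ := by
    intro t₁ h₁ t₂ h₂ h12
    have hsmall : ∀ᶠ ε in 𝓝 (0 : ℝ), |ε| < ε₀ / 2 :=
      continuous_abs.continuousAt.eventually (gt_mem_nhds (by simpa using hε₀))
    apply le_antisymm
    · refine le_of_tendsto_of_tendsto (b := 𝓝[<] (0 : ℝ))
        ((hGc t₁).tendsto 0 |>.mono_left nhdsWithin_le_nhds)
        ((hGc t₂).tendsto 0 |>.mono_left nhdsWithin_le_nhds) ?_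
      filter_upwards [self_mem_nhdsWithin, hsmall.filter_mono nhdsWithin_le_nhds] with ε hε hs
      exact (mul_le_mul_left_of_neg (mem_Iio.1 hε)).1 (hanti ε hs h₁ h₂ h12)
    · refine le_of_tendsto_of_tendsto (b := 𝓝[>] (0 : ℝ))
        ((hGc t₂).tendsto 0 |>.mono_left nhdsWithin_le_nhds)
        ((hGc t₁).tendsto 0 |>.mono_left nhdsWithin_le_nhds) ?_
      filter_upwards [self_mem_nhdsWithin, hsmall.filter_mono nhdsWithin_le_nhds] with ε hε hs
      exact (mul_le_mul_iff_right₀ (mem_Ioi.1 hε)).1 (hanti ε hs h₁ h₂ h12)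
  have hz : (0 : ℝ) ∈ Ioo (-δ) δ := ⟨by linarith, hδ⟩
  have hG0 : ∀ t, G 0 t = b (g t) - ∫ s in (0 : ℝ)..t, c (g s) * a (g s) := by
    intro t; simp [hG, hA, hB]
  have hfin : ∀ t ∈ Ioo (-δ) δ, b (γ t) = b (g 0) + ∫ s in (0 : ℝ)..t, c (g s) * a (g s) := by
    intro t ht
    have : G 0 t = G 0 0 := by
      rcases le_total t 0 with h | h
      · exact hle t ht 0 hz h
      · exact (hle 0 hz t ht h).symm
    rw [hG0, hG0, intervalIntegral.integral_same] at this
    rw [← hgγ t (Ioo_subset_Icc_self ht)]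
    linarith
  have hcont : Continuous fun s => c (g s) * a (g s) := by fun_prop
  have := ((hcont.integral_hasStrictDerivAt 0 0).hasDerivAt.const_add (b (g 0)))
  rw [hgγ 0 (Ioo_subset_Icc_self hz), h0] at this
  refine this.congr_of_eventuallyEq ?_
  filter_upwards [Ioo_mem_nhds hz.1 hz.2] with t ht
  rw [hfin t ht, hgγ 0 (Ioo_subset_Icc_self hz), h0]

theorem swap_preimage_ball (p : ℝ × ℝ) (r : ℝ) : Prod.swap ⁻¹' ball p r = ball p.swap r := by
  ext q
  rw [mem_preimage, ← ball_prod_same, ← ball_prod_same, mem_prod, mem_prod, and_comm]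
  rfl

theorem hasDerivAt_swap {γ : ℝ → ℝ × ℝ} {v : ℝ × ℝ} {t : ℝ} (h : HasDerivAt γ v t) :
    HasDerivAt (fun t => (γ t).swap) v.swap t :=
  (ContinuousLinearEquiv.prodComm ℝ ℝ ℝ).toContinuousLinearMap.hasFDerivAt.comp_hasDerivAt t h

/-- First component of the curvature equation, by reflection in the diagonal. -/
theorem HasCirculation.derivAlong_fst (ha : Continuous a) (hb : Continuous b) (hc : Continuous c)
    {r : ℝ} (h : HasCirculation a b c (ball p r))
    (hunit : ∀ q ∈ ball p r, a q ^ 2 + b q ^ 2 = 1) {q : ℝ × ℝ} (hq : q ∈ ball p r) :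
    DerivAlong (fun q => (a q, b q)) a (-(c q * b q)) q := by
  have h' := h.swap hc
  rw [swap_preimage_ball] at h'
  have hm : ∀ q, q ∈ ball p.swap r ↔ q.swap ∈ ball p r := fun q => by
    rw [← swap_preimage_ball, mem_preimage]
  have key := h'.derivAlong_snd (hb.comp continuous_swap) (ha.comp continuous_swap)
    (hc.comp continuous_swap).neg (fun q hq => by
      rw [← hunit _ ((hm q).1 hq), add_comm]; rfl) (q := q.swap) (by simpa [hm] using hq)
  intro γ h0 hγ
  have := key (fun t => (γ t).swap) (by rw [h0])
    (hγ.mono fun t ht => by simpa using hasDerivAt_swap ht)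
  simpa using this

end potential

/-! ### Integrating factors -/

theorem ContDiffAt.eventually_continuousAt {E F : Type*} [NormedAddCommGroup E] [NormedSpace ℝ E]
    [NormedAddCommGroup F] [NormedSpace ℝ F] {f : E → F} {x : E} (h : ContDiffAt ℝ 1 f x) :
    ∀ᶠ y in 𝓝 x, ContinuousAt f y :=
  (h.eventually (by simp)).mono fun _ hy => hy.continuousAt

theorem eventually_eq_of_hasDerivAt_zero {f : ℝ → ℝ} {t₀ : ℝ}
    (h : ∀ᶠ t in 𝓝 t₀, HasDerivAt f 0 t) : ∀ᶠ t in 𝓝 t₀, f t = f t₀ := by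
  obtain ⟨ε, hε, hb⟩ := Metric.eventually_nhds_iff_ball.1 h
  filter_upwards [ball_mem_nhds t₀ hε] with t ht
  exact isOpen_ball.is_const_of_deriv_eq_zero (convex_ball t₀ ε).isPreconnected
    (fun x hx => (hb x hx).differentiableAt.differentiableWithinAt)
    (fun x hx => (hb x hx).deriv) ht (mem_ball_self hε)

/-- In the coordinates `(x, U)`, with `U` the path potential, the curves orthogonal to `(a, b)` are
the solutions of `dU/dx = P`, where `P` is the vertical primitive of `c`. The right side is merely
continuous in `x`, but `C¹` in `U`, so that the initial value `η` is a `C¹` function. -/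
theorem HasCirculation.exists_integratingFactor_of_snd_ne_zero {a b c : ℝ × ℝ → ℝ}
    (ha : Continuous a) (hb : Continuous b) (hc : Continuous c) {p : ℝ × ℝ} {r : ℝ} (hr : 0 < r)
    (h : HasCirculation a b c (ball p r)) (h0 : b p ≠ 0) :
    ∃ η m : ℝ × ℝ → ℝ, (∀ᶠ q in 𝓝 p, HasFDerivAt η (form (m q * a q) (m q * b q)) q) ∧
      (∀ᶠ q in 𝓝 p, ContinuousAt m q) ∧ (∀ᶠ q in 𝓝 p, 0 < m q) ∧
      ∀ᶠ q in 𝓝 p, DerivAlong (fun q => (b q, -a q)) m (-(c q * m q)) q := by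
  set U := pathPotential a b p with hU
  set P := vertPrimitive c p with hP
  have hPc : Continuous P := continuous_vertPrimitive hc
  have hUc : Continuous U := continuous_pathPotential ha hb
  have hUp : U p = 0 := by simp [hU, pathPotential]
  have hUd : ∀ᶠ q in 𝓝 p, HasFDerivAt U (form (a q + P q) (b q)) q := by
    filter_upwards [ball_mem_nhds p hr] with q hq
    exact h.hasFDerivAt_pathPotential ha hb hc hq
  have hU1 : ContDiffAt ℝ 1 U p := contDiffAt_of_eventually_hasFDerivAt_form hUd
    (Eventually.of_forall fun q => (ha.add hPc).continuousAt)
    (Eventually.of_forall fun q => hb.continuousAt)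
  -- the potential as a new second coordinate
  set Φ : ℝ × ℝ → ℝ × ℝ := fun q => (q.1, U q) with hΦ
  have hΦc : Continuous Φ := by fun_prop
  have hΦp : Φ p = (p.1, 0) := by simp [hΦ, hUp]
  have hΦ1 : ContDiffAt ℝ 1 Φ p := contDiffAt_fst.prodMk hU1
  obtain ⟨Ψ, hΨ1, hΨp, hΨΦ, hΦΨ⟩ := exists_local_inverse hΦ1
    (hasFDerivAt_fst.prodMk hUd.self_of_nhds) (by
      rintro ⟨v, w⟩ hv
      simp only [ContinuousLinearMap.prod_apply, ContinuousLinearMap.coe_fst', form_apply,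
        smul_eq_mul, Prod.mk_eq_zero] at hv
      obtain ⟨rfl, hv⟩ := hv
      simpa [h0] using hv)
  rw [hΦp] at hΨ1 hΨp hΦΨ
  have hΨc : ∀ᶠ z in 𝓝 (p.1, (0 : ℝ)), ContinuousAt Ψ z := ContDiffAt.eventually_continuousAt hΨ1
  have hΨt : Tendsto Ψ (𝓝 (p.1, (0 : ℝ))) (𝓝 p) := by
    have := hΨc.self_of_nhds.tendsto
    rwa [hΨp] at this
  have hΨb : ∀ᶠ z in 𝓝 (p.1, (0 : ℝ)), b (Ψ z) ≠ 0 :=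
    hΨt.eventually (hb.continuousAt.eventually_ne h0)
  obtain ⟨Q, hQc, hQ⟩ := exists_continuous_extension (f := fun z => P (Ψ z))
    (hΨc.mono fun z hz => hPc.continuousAt.comp hz)
  obtain ⟨k, hkc, hk⟩ := exists_continuous_extension (f := fun z => c (Ψ z) / b (Ψ z))
    ((hΨc.and hΨb).mono fun z hz =>
      (hc.continuousAt.comp hz.1).div (hb.continuousAt.comp hz.1) hz.2)
  have hQk : ∀ᶠ z in 𝓝 (p.1, (0 : ℝ)), HasDerivAt (fun w => Q (z.1, w)) (k z) z.2 := by
    filter_upwards [hΨc, hΨb, hk, hQ.eventually_nhds, hΦΨ.eventually_nhds, hΨt.eventually hUd]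
      with z h1 h2 h3 h4 h5 h6
    have hz : Tendsto (fun w => (z.1, w)) (𝓝 z.2) (𝓝 z) := (Continuous.prodMk_right z.1).tendsto z.2
    have e1 : ∀ᶠ w in 𝓝 z.2, Ψ (z.1, w) = (z.1, (Ψ (z.1, w)).2) := by
      filter_upwards [hz.eventually h5] with w hw
      exact Prod.ext (Prod.ext_iff.1 hw).1 rfl
    have e0 : Ψ z = (z.1, (Ψ z).2) := e1.self_of_nhds
    have hY : HasDerivAt (fun w => (Ψ (z.1, w)).2) (b (Ψ z))⁻¹ z.2 := by
      refine HasDerivAt.of_local_left_inverse (f := fun y => U (z.1, y)) ?_ ?_ h2 ?_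
      · exact (continuous_snd.continuousAt.comp h1).comp_of_eq
          (Continuous.prodMk_right z.1).continuousAt rfl
      · have := hasDerivAt_pathPotential_snd (a := a) (p := p) hb (Ψ z)
        rwa [congrArg Prod.fst e0] at this
      · filter_upwards [hz.eventually h5, e1] with w hw hw1
        rw [← hw1]
        exact congrArg Prod.snd hw
    have hd := (hasDerivAt_vertPrimitive_snd (p := p) hc (Ψ z)).comp z.2 hY
    rw [h3, div_eq_mul_inv]
    refine hd.congr_of_eventuallyEq ?_
    filter_upwards [hz.eventually h4, e1] with w hw hw1
    rw [hw, hw1, ← congrArg Prod.fst e0]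
    rfl
  obtain ⟨R, hR, hRd⟩ := Metric.eventually_nhds_iff_ball.1 hQk
  obtain ⟨W, δ, hWc, hδ, hW⟩ := exists_flow hQc hkc hR hRd
  -- the flow of the characteristics, straightened by its local inverse
  set J : ℝ × ℝ → ℝ := fun q => Real.exp (∫ t in p.1..q.1, k (t, W (t, q.2))) with hJ
  have hJc : Continuous J := by
    refine Real.continuous_exp.comp
      (intervalIntegral.continuous_parametric_intervalIntegral_of_continuous ?_ continuous_fst)
    simp only [Function.uncurry_def]
    fun_prop
  have hJpos : ∀ q, 0 < J q := fun q => Real.exp_pos _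
  have hQWc : Continuous fun q : ℝ × ℝ => Q (q.1, W q) := by fun_prop
  have hWd : ∀ᶠ q in 𝓝 (p.1, (0 : ℝ)), HasFDerivAt W (form (Q (q.1, W q)) (J q)) q := by
    filter_upwards [ball_mem_nhds _ hδ] with q hq
    refine (hasStrictFDerivAt_of_partials (fx := fun q => Q (q.1, W q)) (fy := J) ?_ ?_
      hQWc.continuousAt hJc.continuousAt).hasFDerivAt
    · filter_upwards [isOpen_ball.mem_nhds hq] with q' hq' using (hW q' hq').2.2.1
    · filter_upwards [isOpen_ball.mem_nhds hq] with q' hq' using (hW q' hq').2.2.2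
  have hW1 : ContDiffAt ℝ 1 W (p.1, 0) := contDiffAt_of_eventually_hasFDerivAt_form hWd
    (Eventually.of_forall fun q => hQWc.continuousAt)
    (Eventually.of_forall fun q => hJc.continuousAt)
  have hWp : W (p.1, 0) = 0 := (hW _ (mem_ball_self hδ)).1
  obtain ⟨g, hg1, hgp, -, hGg⟩ := exists_local_inverse
    (f := fun q => (q.1, W q)) (p := (p.1, 0)) (contDiffAt_fst.prodMk hW1)
    (hasFDerivAt_fst.prodMk hWd.self_of_nhds) (by
      rintro ⟨v, w⟩ hv
      simp only [ContinuousLinearMap.prod_apply, ContinuousLinearMap.coe_fst', form_apply,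
        smul_eq_mul, Prod.mk_eq_zero] at hv
      obtain ⟨rfl, hv⟩ := hv
      simpa [(hJpos _).ne'] using hv)
  simp only [hWp] at hg1 hgp hGg
  set ζ : ℝ × ℝ → ℝ × ℝ := fun q => g (Φ q) with hζ
  have hΦt : Tendsto Φ (𝓝 p) (𝓝 (p.1, 0)) := hΦp ▸ hΦc.tendsto p
  have hζ1 : ContDiffAt ℝ 1 ζ p := ContDiffAt.comp p (by rwa [hΦp]) hΦ1
  have hζc : ∀ᶠ q in 𝓝 p, ContinuousAt ζ q := ContDiffAt.eventually_continuousAt hζ1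
  have hζt : Tendsto ζ (𝓝 p) (𝓝 (p.1, 0)) := by
    have := hζc.self_of_nhds.tendsto
    rwa [show ζ p = (p.1, 0) by rw [hζ]; simp only [hΦp, hgp]] at this
  have hGζ : ∀ᶠ q in 𝓝 p, (ζ q).1 = q.1 ∧ W (ζ q) = U q := by
    filter_upwards [hΦt.eventually hGg] with q hq
    exact Prod.ext_iff.1 hq
  have hηd : ∀ᶠ q in 𝓝 p, HasFDerivAt (fun q => (ζ q).2)
      (form ((J (ζ q))⁻¹ * a q) ((J (ζ q))⁻¹ * b q)) q := by
    filter_upwards [hζ1.eventually (by simp), hGζ.eventually_nhds, hUd, hζt.eventually hWd,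
      hΦt.eventually hQ, hΨΦ] with q h1 h2 h3 h4 h5 h6
    have hL := (h1.differentiableAt one_ne_zero).snd.hasFDerivAt
    set L := fderiv ℝ (fun q => (ζ q).2) q
    have e0 : (q.1, (ζ q).2) = ζ q := Prod.ext h2.self_of_nhds.1.symm rfl
    have hcomp : HasFDerivAt (fun q => W (q.1, (ζ q).2)) ((form (Q (q.1, U q)) (J (ζ q))).comp
        ((ContinuousLinearMap.fst ℝ ℝ ℝ).prod L)) q := by
      refine HasFDerivAt.comp q ?_ (hasFDerivAt_fst.prodMk hL)
      rw [e0]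
      rwa [h2.self_of_nhds.1, h2.self_of_nhds.2] at h4
    have huniq := (hcomp.congr_of_eventuallyEq (f₁ := U) (by
      filter_upwards [h2] with q' hq'
      rw [← hq'.2]
      congr 1
      exact Prod.ext hq'.1 rfl)).unique h3
    have hQP : Q (q.1, U q) = P q := by
      rw [show (q.1, U q) = Φ q from rfl, h5, h6]
    refine hL.congr_fderiv (ContinuousLinearMap.ext fun v => ?_)
    have e := congrArg (fun A => A v) huniq
    have hJ0 := (hJpos (ζ q)).ne'
    simp only [ContinuousLinearMap.comp_apply, ContinuousLinearMap.prod_apply,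
      ContinuousLinearMap.coe_fst', form_apply, smul_eq_mul, hQP] at e ⊢
    field_simp
    linarith
  refine ⟨fun q => (ζ q).2, fun q => (J (ζ q))⁻¹, hηd, ?_,
    Eventually.of_forall fun q => inv_pos.2 (hJpos _), ?_⟩
  · filter_upwards [hζc] with q hq
    exact (hJc.continuousAt.comp hq).inv₀ (hJpos _).ne'
  · filter_upwards [hηd.eventually_nhds, hGζ.eventually_nhds, hΦt.eventually hk, hΨΦ,
      hb.continuousAt.eventually_ne h0] with q h1 h2 h3 h4 h5
    intro γ hγ0 hγ
    have hγt : Tendsto γ (𝓝 0) (𝓝 q) := hγ0 ▸ hγ.self_of_nhds.continuousAt.tendsto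
    -- the new coordinate is constant along the characteristic
    have hconst : ∀ᶠ t in 𝓝 0, (ζ (γ t)).2 = (ζ q).2 := by
      rw [← hγ0]
      refine eventually_eq_of_hasDerivAt_zero (f := fun t => (ζ (γ t)).2) ?_
      filter_upwards [hγ, hγt.eventually h1] with t ht h1t
      refine (h1t.comp_hasDerivAt t ht).congr_deriv ?_
      simp only [form_apply, smul_eq_mul]
      ring
    have hkc' : Continuous fun t => k (t, W (t, (ζ q).2)) := by fun_prop
    have hγ1 : HasDerivAt (fun t => (γ t).1) (b q) 0 := by
      have := hγ.self_of_nhds.fst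
      rwa [hγ0] at this
    have hI := (hkc'.integral_hasStrictDerivAt p.1 q.1).hasDerivAt.comp_of_eq 0 hγ1 (by rw [hγ0])
    have e0 : (q.1, (ζ q).2) = ζ q := Prod.ext h2.self_of_nhds.1.symm rfl
    have hkq : k (q.1, W (q.1, (ζ q).2)) = c q / b q := by
      rw [e0, h2.self_of_nhds.2, show (q.1, U q) = Φ q from rfl, h3, h4]
    rw [hkq, div_mul_cancel₀ _ h5] at hI
    have hfin := hI.neg.exp
    have hJq : J (ζ q) = Real.exp (∫ t in p.1..q.1, k (t, W (t, (ζ q).2))) := by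
      simp only [hJ, h2.self_of_nhds.1]
    refine (hfin.congr_of_eventuallyEq ?_).congr_deriv ?_
    · filter_upwards [hconst, hγt.eventually h2] with t ht ht'
      simp only [hJ, Pi.neg_apply, Function.comp_apply, Real.exp_neg, ht, ht'.1]
    · simp only [Pi.neg_apply, Function.comp_apply, hγ0, Real.exp_neg, hJq]
      ring

/-- A continuous planar field with continuous curl has, near a point where it does not vanish, an
integrating factor `m` with a `C¹` potential `η`. Along the curves orthogonal to the field, `m`
satisfies the equation that expresses that `m • (a, b)` is curl-free. -/
theorem HasCirculation.exists_integratingFactor {a b c : ℝ × ℝ → ℝ}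
    (ha : Continuous a) (hb : Continuous b) (hc : Continuous c) {p : ℝ × ℝ} {r : ℝ} (hr : 0 < r)
    (h : HasCirculation a b c (ball p r)) (h0 : a p ≠ 0 ∨ b p ≠ 0) :
    ∃ η m : ℝ × ℝ → ℝ, (∀ᶠ q in 𝓝 p, HasFDerivAt η (form (m q * a q) (m q * b q)) q) ∧
      (∀ᶠ q in 𝓝 p, ContinuousAt m q) ∧ (∀ᶠ q in 𝓝 p, 0 < m q) ∧
      ∀ᶠ q in 𝓝 p, DerivAlong (fun q => (b q, -a q)) m (-(c q * m q)) q := by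
  rcases h0 with h0 | h0
  swap
  · exact h.exists_integratingFactor_of_snd_ne_zero ha hb hc hr h0
  have h' := h.swap hc
  rw [swap_preimage_ball] at h'
  obtain ⟨η, m, h1, h2, h3, h4⟩ := h'.exists_integratingFactor_of_snd_ne_zero
    (hb.comp continuous_swap) (ha.comp continuous_swap) (hc.comp continuous_swap).neg hr
    (by simpa using h0)
  have ht : Tendsto Prod.swap (𝓝 p) (𝓝 p.swap) := continuous_swap.tendsto p
  refine ⟨η ∘ Prod.swap, m ∘ Prod.swap, ?_, ?_, ht.eventually h3, ?_⟩
  · filter_upwards [ht.eventually h1] with q hq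
    refine (hq.comp q
      (ContinuousLinearEquiv.prodComm ℝ ℝ ℝ).toContinuousLinearMap.hasFDerivAt).congr_fderiv
      (ContinuousLinearMap.ext fun v => ?_)
    simp [add_comm]
  · filter_upwards [ht.eventually h2] with q hq
    exact hq.comp continuous_swap.continuousAt
  · filter_upwards [ht.eventually h4] with q hq
    intro γ hγ0 hγ
    -- the reflection of `γ`, run backwards, is orthogonal to the reflected field
    have hneg : Tendsto (fun t : ℝ => -t) (𝓝 0) (𝓝 0) := by
      simpa using (continuous_neg.tendsto (0 : ℝ))
    have hd := hq (fun t => (γ (-t)).swap) (by simp [hγ0]) (by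
      filter_upwards [hneg.eventually hγ] with t htt
      have := hasDerivAt_swap (htt.scomp t (hasDerivAt_neg t))
      refine this.congr_deriv ?_
      simp)
    have := (hd.scomp_of_eq (0 : ℝ) (hasDerivAt_neg (0 : ℝ)) (by simp))
    refine (this.congr_of_eventuallyEq (Eventually.of_forall fun t => by simp)).congr_deriv ?_
    simp

/-! ### Criteria for Green's formula -/

theorem hasCirculation_of_hasFDerivAt {a b : ℝ × ℝ → ℝ} {a' b' : ℝ × ℝ → ℝ × ℝ →L[ℝ] ℝ}
    {c : ℝ × ℝ → ℝ} {S : Set (ℝ × ℝ)} (ha : ContinuousOn a S) (hb : ContinuousOn b S)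
    (hc : ContinuousOn c S)
    (hda : ∀ q ∈ S, HasFDerivAt a (a' q) q) (hdb : ∀ q ∈ S, HasFDerivAt b (b' q) q)
    (hcurl : ∀ q ∈ S, c q = b' q (1, 0) - a' q (0, 1)) : HasCirculation a b c S := by
  intro x₁ x₂ y₁ y₂ hS
  have hcomp : IsCompact (uIcc x₁ x₂ ×ˢ uIcc y₁ y₂) := isCompact_uIcc.prod isCompact_uIcc
  have hsub : ∀ q ∈ Ioo (min x₁ x₂) (max x₁ x₂) ×ˢ Ioo (min y₁ y₂) (max y₁ y₂), q ∈ S :=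
    fun q hq => hS ⟨Ioo_subset_Icc_self hq.1, Ioo_subset_Icc_self hq.2⟩
  have := integral2_divergence_prod_of_hasFDerivAt b (fun q => -a q) b' (fun q => -a' q) x₁ y₁ x₂ y₂
    (hb.mono hS) (ha.mono hS).neg (fun q hq => hdb q (hsub q hq))
    (fun q hq => (hda q (hsub q hq)).neg) (by
      refine ((hc.mono hS).integrableOn_compact hcomp).congr_fun (fun q hq => ?_)
        hcomp.measurableSet
      simp only [hcurl q (hS hq), neg_apply]
      ring)
  have e : (∫ x in x₁..x₂, ∫ y in y₁..y₂, b' (x, y) (1, 0) + (-a' (x, y)) (0, 1)) =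
      ∫ x in x₁..x₂, ∫ y in y₁..y₂, c (x, y) := by
    refine intervalIntegral.integral_congr fun x hx =>
      intervalIntegral.integral_congr fun y hy => ?_
    simp only [hcurl (x, y) (hS ⟨hx, hy⟩), neg_apply]
    ring
  rw [← e, this]
  simp only [intervalIntegral.integral_neg]
  ring

theorem HasCirculation.congr {a b c a' b' c' : ℝ × ℝ → ℝ} {S : Set (ℝ × ℝ)}
    (h : HasCirculation a b c S) (ha : EqOn a' a S) (hb : EqOn b' b S) (hc : EqOn c' c S) :
    HasCirculation a' b' c' S := by
  intro x₁ x₂ y₁ y₂ hS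
  rw [intervalIntegral.integral_congr (g := fun x => a (x, y₁))
      (fun x hx => ha (hS ⟨hx, left_mem_uIcc⟩)),
    intervalIntegral.integral_congr (g := fun x => a (x, y₂))
      (fun x hx => ha (hS ⟨hx, right_mem_uIcc⟩)),
    intervalIntegral.integral_congr (g := fun y => b (x₁, y))
      (fun x hx => hb (hS ⟨left_mem_uIcc, hx⟩)),
    intervalIntegral.integral_congr (g := fun y => b (x₂, y))
      (fun x hx => hb (hS ⟨right_mem_uIcc, hx⟩)), h x₁ x₂ y₁ y₂ hS]
  exact intervalIntegral.integral_congr fun x hx =>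
    intervalIntegral.integral_congr fun y hy => (hc (hS ⟨hx, hy⟩)).symm

/-- Adding the gradient of a `C¹` function does not change the curl, although the gradient need
not be differentiable. -/
theorem HasCirculation.add_gradient {a b c : ℝ × ℝ → ℝ} {S : Set (ℝ × ℝ)}
    (h : HasCirculation a b c S) (ha : ContinuousOn a S) (hb : ContinuousOn b S)
    {G : ℝ × ℝ → ℝ} {G' : ℝ × ℝ → ℝ × ℝ →L[ℝ] ℝ} (hG : ∀ q ∈ S, HasFDerivAt G (G' q) q)
    (hG' : ContinuousOn G' S) :
    HasCirculation (fun q => G' q (1, 0) + a q) (fun q => G' q (0, 1) + b q) c S := by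
  intro x₁ x₂ y₁ y₂ hS
  have hx : ∀ y ∈ uIcc y₁ y₂, (∫ x in x₁..x₂, (G' (x, y) (1, 0) + a (x, y)))
      = G (x₂, y) - G (x₁, y) + ∫ x in x₁..x₂, a (x, y) := by
    intro y hy
    have hm : MapsTo (fun x => (x, y)) (uIcc x₁ x₂) S := fun x hx => hS ⟨hx, hy⟩
    have hc : ContinuousOn (fun x => (x, y)) (uIcc x₁ x₂) :=
      (Continuous.prodMk_left y).continuousOn
    have hi : IntervalIntegrable (fun x => G' (x, y) (1, 0)) volume x₁ x₂ :=
      ContinuousOn.intervalIntegrable ((hG'.comp hc hm).clm_apply continuousOn_const)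
    have hi' : IntervalIntegrable (fun x => a (x, y)) volume x₁ x₂ :=
      (ha.comp hc hm).intervalIntegrable
    rw [intervalIntegral.integral_add hi hi',
      intervalIntegral.integral_eq_sub_of_hasDerivAt (f := fun x => G (x, y)) (fun x hx =>
        (hG (x, y) (hm hx)).comp_hasDerivAt x ((hasDerivAt_id x).prodMk (hasDerivAt_const x y))) hi]
  have hy : ∀ x ∈ uIcc x₁ x₂, (∫ y in y₁..y₂, (G' (x, y) (0, 1) + b (x, y)))
      = G (x, y₂) - G (x, y₁) + ∫ y in y₁..y₂, b (x, y) := by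
    intro x hx
    have hm : MapsTo (fun y => (x, y)) (uIcc y₁ y₂) S := fun y hy => hS ⟨hx, hy⟩
    have hc : ContinuousOn (fun y => (x, y)) (uIcc y₁ y₂) :=
      (Continuous.prodMk_right x).continuousOn
    have hi : IntervalIntegrable (fun y => G' (x, y) (0, 1)) volume y₁ y₂ :=
      ContinuousOn.intervalIntegrable ((hG'.comp hc hm).clm_apply continuousOn_const)
    have hi' : IntervalIntegrable (fun y => b (x, y)) volume y₁ y₂ :=
      (hb.comp hc hm).intervalIntegrable
    rw [intervalIntegral.integral_add hi hi',
      intervalIntegral.integral_eq_sub_of_hasDerivAt (f := fun y => G (x, y)) (fun y hy =>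
        (hG (x, y) (hm hy)).comp_hasDerivAt y ((hasDerivAt_const y x).prodMk (hasDerivAt_id y))) hi]
  rw [hx _ left_mem_uIcc, hx _ right_mem_uIcc, hy _ left_mem_uIcc, hy _ right_mem_uIcc,
    ← h x₁ x₂ y₁ y₂ hS]
  ring

/-- Circulation is stable under pointwise approximation with uniform error bounds. -/
theorem hasCirculation_of_approx {a b c : ℝ × ℝ → ℝ} {S : Set (ℝ × ℝ)} (ha : Continuous a)
    (hb : Continuous b) (hc : Continuous c)
    (h : ∀ ε > 0, ∃ A B C : ℝ × ℝ → ℝ, Continuous A ∧ Continuous B ∧ Continuous C ∧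
      HasCirculation A B C S ∧ ∀ q ∈ S, |A q - a q| ≤ ε ∧ |B q - b q| ≤ ε ∧ |C q - c q| ≤ ε) :
    HasCirculation a b c S := by
  intro x₁ x₂ y₁ y₂ hS
  rw [← sub_eq_zero, ← abs_nonpos_iff]
  set M := 2 * |x₂ - x₁| + 2 * |y₂ - y₁| + |y₂ - y₁| * |x₂ - x₁| with hM
  have key : ∀ ε > 0, |(∫ x in x₁..x₂, a (x, y₁)) + (∫ y in y₁..y₂, b (x₂, y))
      - (∫ x in x₁..x₂, a (x, y₂)) - (∫ y in y₁..y₂, b (x₁, y))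
      - ∫ x in x₁..x₂, ∫ y in y₁..y₂, c (x, y)| ≤ ε * M := by
    intro ε hε
    obtain ⟨A, B, C, hA, hB, hC, hcirc, happ⟩ := h ε hε
    have e := hcirc x₁ x₂ y₁ y₂ hS
    have bx : ∀ {f g : ℝ × ℝ → ℝ}, Continuous f → Continuous g →
        (∀ q ∈ S, |f q - g q| ≤ ε) → ∀ y ∈ uIcc y₁ y₂,
        |(∫ x in x₁..x₂, f (x, y)) - ∫ x in x₁..x₂, g (x, y)| ≤ ε * |x₂ - x₁| := by
      intro f g hf hg hfg y hy
      rw [← intervalIntegral.integral_sub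
        ((by fun_prop : Continuous fun x => f (x, y)).intervalIntegrable _ _)
        ((by fun_prop : Continuous fun x => g (x, y)).intervalIntegrable _ _)]
      exact intervalIntegral.norm_integral_le_of_norm_le_const fun x hx =>
        (Real.norm_eq_abs _).trans_le <| hfg _ (hS ⟨uIoc_subset_uIcc hx, hy⟩)
    have byy : ∀ {f g : ℝ × ℝ → ℝ}, Continuous f → Continuous g →
        (∀ q ∈ S, |f q - g q| ≤ ε) → ∀ x ∈ uIcc x₁ x₂,
        |(∫ y in y₁..y₂, f (x, y)) - ∫ y in y₁..y₂, g (x, y)| ≤ ε * |y₂ - y₁| := by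
      intro f g hf hg hfg x hx
      rw [← intervalIntegral.integral_sub
        ((by fun_prop : Continuous fun y => f (x, y)).intervalIntegrable _ _)
        ((by fun_prop : Continuous fun y => g (x, y)).intervalIntegrable _ _)]
      exact intervalIntegral.norm_integral_le_of_norm_le_const fun y hy =>
        (Real.norm_eq_abs _).trans_le <| hfg _ (hS ⟨hx, uIoc_subset_uIcc hy⟩)
    have hint : ∀ {f : ℝ × ℝ → ℝ}, Continuous f → IntervalIntegrable
        (fun x => ∫ y in y₁..y₂, f (x, y)) volume x₁ x₂ := fun hf =>
      (intervalIntegral.continuous_parametric_intervalIntegral_of_continuous' (by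
        simpa only [Function.uncurry_def] using hf) _ _).intervalIntegrable _ _
    have i1 := abs_le.1 (bx hA ha (fun q hq => (happ q hq).1) y₁ left_mem_uIcc)
    have i2 := abs_le.1 (bx hA ha (fun q hq => (happ q hq).1) y₂ right_mem_uIcc)
    have i3 := abs_le.1 (byy hB hb (fun q hq => (happ q hq).2.1) x₁ left_mem_uIcc)
    have i4 := abs_le.1 (byy hB hb (fun q hq => (happ q hq).2.1) x₂ right_mem_uIcc)
    have i5 : |(∫ x in x₁..x₂, ∫ y in y₁..y₂, C (x, y)) - ∫ x in x₁..x₂, ∫ y in y₁..y₂, c (x, y)|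
        ≤ ε * |y₂ - y₁| * |x₂ - x₁| := by
      rw [← intervalIntegral.integral_sub (hint hC) (hint hc)]
      exact intervalIntegral.norm_integral_le_of_norm_le_const fun x hx =>
        (Real.norm_eq_abs _).trans_le <|
          byy hC hc (fun q hq => (happ q hq).2.2) x (uIoc_subset_uIcc hx)
    have i5' := abs_le.1 i5
    have hMe : ε * M = ε * |x₂ - x₁| + ε * |x₂ - x₁| + ε * |y₂ - y₁| + ε * |y₂ - y₁|
      + ε * |y₂ - y₁| * |x₂ - x₁| := by rw [hM]; ring
    rw [hMe, abs_le]
    constructor <;> linarith [i1.1, i1.2, i2.1, i2.2, i3.1, i3.2, i4.1, i4.2, i5'.1, i5'.2]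
  have hlim : Tendsto (fun ε => ε * M) (𝓝[>] (0 : ℝ)) (𝓝 0) := by
    have : Tendsto (fun ε => ε * M) (𝓝 (0 : ℝ)) (𝓝 (0 * M)) :=
      (continuous_mul_const M).tendsto 0
    rw [zero_mul] at this
    exact this.mono_left nhdsWithin_le_nhds
  refine ge_of_tendsto hlim ?_
  filter_upwards [self_mem_nhdsWithin] with ε hε using key ε hε

open scoped Convolution in
/-- A continuous field `(n₁, n₂)` with divergence `h` in the sense of distributions satisfies
Green's formula: the rotated field `(n₂, -n₁)` has curl `-h`. The field is mollified; the mollified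
field has the mollified divergence, which is `h` up to a uniformly small error. -/
theorem hasCirculation_of_weak_divergence {n₁ n₂ h : ℝ × ℝ → ℝ} (h₁ : Continuous n₁)
    (h₂ : Continuous n₂) (hh : Continuous h) {p : ℝ × ℝ} {r R : ℝ} (hrR : r < R)
    (hweak : ∀ φ : ℝ × ℝ → ℝ, ContDiff ℝ ∞ φ → HasCompactSupport φ → tsupport φ ⊆ ball p R →
      (∫ q, n₁ q * fderiv ℝ φ q (1, 0) + n₂ q * fderiv ℝ φ q (0, 1) + h q * φ q) = 0) :
    HasCirculation n₂ (fun q => -n₁ q) (fun q => -h q) (ball p r) := by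
  refine hasCirculation_of_approx h₂ h₁.neg hh.neg fun ε hε => ?_
  -- uniform continuity on a compact ball
  have huc : ∀ {f : ℝ × ℝ → ℝ}, Continuous f → ∃ δ > 0, ∀ q ∈ ball p r, ∀ q' ∈ ball q δ,
      dist (f q') (f q) ≤ ε := by
    intro f hf
    have hu := (isCompact_closedBall p (r + 1)).uniformContinuousOn_of_continuous hf.continuousOn
    obtain ⟨δ, hδ, hd⟩ := Metric.uniformContinuousOn_iff.1 hu ε hε
    refine ⟨min δ 1, by positivity, fun q hq q' hq' => (hd q' ?_ q ?_ ?_).le⟩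
    · rw [mem_closedBall]
      have := dist_triangle q' q p
      have h3 := mem_ball.1 hq'
      have h4 := mem_ball.1 hq
      linarith [min_le_right δ 1]
    · exact (mem_ball.1 hq).le.trans (by linarith)
    · exact (mem_ball.1 hq').trans_le (min_le_left _ _)
  obtain ⟨δ₁, hδ₁, hu₁⟩ := huc h₁
  obtain ⟨δ₂, hδ₂, hu₂⟩ := huc h₂
  obtain ⟨δ₃, hδ₃, hu₃⟩ := huc hh
  set δ := min (min δ₁ δ₂) (min δ₃ (R - r)) with hδ
  have hδ0 : 0 < δ := by
    have : 0 < R - r := by linarith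
    positivity
  let φ : ContDiffBump (0 : ℝ × ℝ) := ⟨δ / 2, δ, by positivity, by linarith⟩
  set ρ : ℝ × ℝ → ℝ := φ.normed volume with hρ
  have hρs : ContDiff ℝ ∞ ρ := φ.contDiff_normed
  have hρ1 : ContDiff ℝ 1 ρ := φ.contDiff_normed
  have hρc : HasCompactSupport ρ := φ.hasCompactSupport_normed
  set m : (ℝ × ℝ → ℝ) → ℝ × ℝ → ℝ := fun f => ρ ⋆[ContinuousLinearMap.lsmul ℝ ℝ, volume] f with hm
  have hmd : ∀ {f : ℝ × ℝ → ℝ}, Continuous f → ∀ q, HasFDerivAt (m f)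
      ((fderiv ℝ ρ ⋆[(ContinuousLinearMap.lsmul ℝ ℝ).precompL (ℝ × ℝ), volume] f) q) q :=
    fun hf q => hρc.hasFDerivAt_convolution_left _ hρ1 hf.locallyIntegrable q
  have hmc : ∀ {f : ℝ × ℝ → ℝ}, Continuous f → Continuous (m f) := fun hf =>
    continuous_iff_continuousAt.2 fun q => (hmd hf q).continuousAt
  have hmapp : ∀ {f : ℝ × ℝ → ℝ} {δ' : ℝ}, Continuous f → δ ≤ δ' →
      (∀ q ∈ ball p r, ∀ q' ∈ ball q δ', dist (f q') (f q) ≤ ε) →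
      ∀ q ∈ ball p r, |m f q - f q| ≤ ε := by
    intro f δ' hf hle hd q hq
    exact φ.dist_normed_convolution_le hf.aestronglyMeasurable fun q' hq' =>
      hd q hq q' (ball_subset_ball hle hq')
  -- the mollified equation, by testing with a translated mollifier
  have hdiv : ∀ q ∈ ball p r,
      (fderiv ℝ ρ ⋆[(ContinuousLinearMap.lsmul ℝ ℝ).precompL (ℝ × ℝ), volume] n₁) q (1, 0) +
      (fderiv ℝ ρ ⋆[(ContinuousLinearMap.lsmul ℝ ℝ).precompL (ℝ × ℝ), volume] n₂) q (0, 1)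
        = m h q := by
    intro q hq
    have hsub : ∀ x, HasFDerivAt (fun x => ρ (q - x)) (-(fderiv ℝ ρ (q - x))) x := fun x => by
      have := ((hρ1.differentiable one_ne_zero) (q - x)).hasFDerivAt.comp x
        ((hasFDerivAt_id x).const_sub q)
      exact this.congr_fderiv (ContinuousLinearMap.ext fun v => by simp)
    have hsupp : tsupport (fun x => ρ (q - x)) ⊆ closedBall q δ := by
      refine closure_minimal (fun x hx => ?_) isClosed_closedBall
      have h1 : q - x ∈ tsupport ρ := subset_tsupport ρ hx
      rw [hρ, φ.tsupport_normed_eq, mem_closedBall, dist_zero_right] at h1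
      rw [mem_closedBall, dist_comm, dist_eq_norm]
      exact h1
    have hcs : HasCompactSupport fun x => ρ (q - x) :=
      HasCompactSupport.of_support_subset_isCompact (isCompact_closedBall q δ)
        ((subset_tsupport _).trans hsupp)
    have hcv : ∀ {f : ℝ × ℝ → ℝ}, Continuous f → ∀ v : ℝ × ℝ,
        Integrable (fun x => f x * fderiv ℝ ρ (q - x) v) ∧
        (fderiv ℝ ρ ⋆[(ContinuousLinearMap.lsmul ℝ ℝ).precompL (ℝ × ℝ), volume] f) q v =
          ∫ x, f x * fderiv ℝ ρ (q - x) v := by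
      intro f hf v
      have hex := (hρc.fderiv ℝ).convolutionExists_left (μ := volume) (g := f)
        ((ContinuousLinearMap.lsmul ℝ ℝ).precompL (ℝ × ℝ)) (hρ1.continuous_fderiv one_ne_zero)
        hf.locallyIntegrable q
      have hex' := (convolutionExistsAt_iff_integrable_swap).1 hex
      have hpt : ∀ x, ((ContinuousLinearMap.lsmul ℝ ℝ).precompL (ℝ × ℝ)) (fderiv ℝ ρ (q - x))
          (f x) v = f x * fderiv ℝ ρ (q - x) v := fun x => by
        simp [ContinuousLinearMap.precompL_apply, mul_comm]
      constructor
      · refine (hex'.apply_continuousLinearMap v).congr (Eventually.of_forall fun x => ?_)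
        exact hpt x
      · rw [convolution_eq_swap, ContinuousLinearMap.integral_apply hex' v]
        exact integral_congr_ae (Eventually.of_forall hpt)
    have hmh : m h q = ∫ x, h x * ρ (q - x) := by
      rw [hm]
      simp only [convolution_eq_swap]
      refine integral_congr_ae (Eventually.of_forall fun x => ?_)
      simp [mul_comm]
    have hih : Integrable fun x => h x * ρ (q - x) := by
      refine Continuous.integrable_of_hasCompactSupport
        (hh.mul (hρ1.continuous.comp (by fun_prop))) hcs.mul_left
    have hw := hweak (fun x => ρ (q - x)) (hρs.comp (contDiff_const.sub contDiff_id)) hcs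
      (hsupp.trans fun x hx => by
        have h1 := mem_ball.1 hq
        have h2 := mem_closedBall.1 hx
        have h3 : δ ≤ R - r := (min_le_right _ _).trans (min_le_right _ _)
        rw [mem_ball]
        linarith [dist_triangle x q p])
    simp only [fun x => (hsub x).fderiv, neg_apply, mul_neg] at hw
    have h1 := hcv h₁ (1, 0)
    have h2 := hcv h₂ (0, 1)
    have i1 : Integrable fun x => -(n₁ x * fderiv ℝ ρ (q - x) (1, 0)) := h1.1.neg
    have i2 : Integrable fun x => -(n₂ x * fderiv ℝ ρ (q - x) (0, 1)) := h2.1.neg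
    have i12 : Integrable fun x => -(n₁ x * fderiv ℝ ρ (q - x) (1, 0)) +
      -(n₂ x * fderiv ℝ ρ (q - x) (0, 1)) := i1.add i2
    rw [integral_add i12 hih, integral_add i1 i2] at hw
    simp only [integral_neg] at hw
    rw [h1.2, h2.2, hmh]
    linarith
  refine ⟨m n₂, fun q => -m n₁ q, fun q => -m h q, hmc h₂, (hmc h₁).neg, (hmc hh).neg, ?_,
    fun q hq => ⟨?_, ?_, ?_⟩⟩
  · refine hasCirculation_of_hasFDerivAt (hmc h₂).continuousOn (hmc h₁).neg.continuousOn
      (hmc hh).neg.continuousOn (fun q _ => hmd h₂ q) (fun q _ => (hmd h₁ q).neg) fun q hq => ?_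
    rw [← hdiv q hq, neg_apply]
    ring
  · exact hmapp h₂ ((min_le_left _ _).trans (min_le_right _ _)) hu₂ q hq
  · rw [neg_sub_neg, abs_sub_comm]
    exact hmapp h₁ ((min_le_left _ _).trans (min_le_left _ _)) hu₁ q hq
  · rw [neg_sub_neg, abs_sub_comm]
    exact hmapp hh ((min_le_right _ _).trans (min_le_left _ _)) hu₃ q hq

/-! ### The rotation of the normal in orthogonal coordinates -/

theorem mem_ball_prod_real {o z : ℝ × ℝ} {r : ℝ} :
    z ∈ ball o r ↔ z.1 ∈ ball o.1 r ∧ z.2 ∈ ball o.2 r := by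
  rw [← ball_prod_same, mem_prod]

theorem hasDerivAt_primitive_param {E : Type*} [NormedAddCommGroup E] [NormedSpace ℝ E]
    {φ φ' : ℝ × ℝ → E} {o z : ℝ × ℝ} {r : ℝ} (hφ : Continuous φ) (hφ' : Continuous φ')
    (h : ∀ z ∈ ball o r, HasDerivAt (fun t => φ (z.1, t)) (φ' z) z.2) (hz : z ∈ ball o r) :
    HasDerivAt (fun t => ∫ s in o.1..z.1, φ (s, t)) (∫ s in o.1..z.1, φ' (s, z.2)) z.2 := by
  have hz' := mem_ball_prod_real.1 hz
  obtain ⟨δ, hδ, hb⟩ := Metric.isOpen_iff.1 isOpen_ball z.2 hz'.2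
  refine hasDerivAt_intervalIntegral_param hδ hφ hφ' fun s hs t ht => h (s, t) ?_
  refine mem_ball_prod_real.2 ⟨?_, hb ht⟩
  exact (convex_ball o.1 r).ordConnected.uIcc_subset
    (mem_ball_self (pos_of_mem_ball hz)) hz'.1 hs

theorem continuous_horPrimitive {E : Type*} [NormedAddCommGroup E] [NormedSpace ℝ E]
    {φ : ℝ × ℝ → E} (hφ : Continuous φ) (s₀ : ℝ) :
    Continuous fun z : ℝ × ℝ => ∫ s in s₀..z.1, φ (s, z.2) := by
  refine intervalIntegral.continuous_parametric_intervalIntegral_of_continuous ?_ continuous_fst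
  simp only [Function.uncurry_def]
  fun_prop

theorem hasDerivAt_horPrimitive {E : Type*} [NormedAddCommGroup E] [NormedSpace ℝ E]
    [CompleteSpace E] {φ : ℝ × ℝ → E} (hφ : Continuous φ) (s₀ : ℝ) (z : ℝ × ℝ) :
    HasDerivAt (fun s => ∫ σ in s₀..s, φ (σ, z.2)) (φ z) z.1 :=
  ((by fun_prop : Continuous fun s => φ (s, z.2)).integral_hasStrictDerivAt s₀ z.1).hasDerivAt

theorem sub_eq_horPrimitive {E : Type*} [NormedAddCommGroup E] [NormedSpace ℝ E]
    [CompleteSpace E] {X φ : ℝ × ℝ → E} {o z : ℝ × ℝ} {r : ℝ} (hφ : Continuous φ)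
    (h : ∀ z ∈ ball o r, HasDerivAt (fun s => X (s, z.2)) (φ z) z.1) (hz : z ∈ ball o r) :
    X z - X (o.1, z.2) = ∫ s in o.1..z.1, φ (s, z.2) := by
  have hz' := mem_ball_prod_real.1 hz
  rw [intervalIntegral.integral_eq_sub_of_hasDerivAt (f := fun s => X (s, z.2))]
  · intro s hs
    refine h (s, z.2) (mem_ball_prod_real.2 ⟨?_, hz'.2⟩)
    exact (convex_ball o.1 r).ordConnected.uIcc_subset
      (mem_ball_self (pos_of_mem_ball hz)) hz'.1 hs
  · exact (by fun_prop : Continuous fun s => φ (s, z.2)).intervalIntegrable _ _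

/-- The derivative of a curve in the unit circle is tangential. -/
theorem eq_I_mul_of_hasDerivAt_unit {n : ℝ → ℂ} {v : ℂ} {t : ℝ}
    (hn : ∀ᶠ t in 𝓝 t, ‖n t‖ = 1) (h : HasDerivAt n v t) :
    v = Complex.I * ((v * starRingEnd ℂ (n t)).im : ℂ) * n t := by
  have h1 : HasDerivAt (fun t => n t * starRingEnd ℂ (n t))
      (v * starRingEnd ℂ (n t) + n t * starRingEnd ℂ v) t := h.mul h.star
  have h2 : HasDerivAt (fun t => n t * starRingEnd ℂ (n t)) 0 t := by
    refine (hasDerivAt_const t (1 : ℂ)).congr_of_eventuallyEq ?_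
    filter_upwards [hn] with s hs
    rw [Complex.mul_conj, Complex.normSq_eq_norm_sq, hs]; simp
  have h3 := h1.unique h2
  have h4 : n t * starRingEnd ℂ (n t) = 1 := by
    rw [Complex.mul_conj, Complex.normSq_eq_norm_sq, hn.self_of_nhds]; simp
  have h5 : (v * starRingEnd ℂ (n t)).re = 0 := by
    have := congrArg Complex.re h3
    simp only [Complex.add_re, Complex.mul_re, Complex.conj_re, Complex.conj_im,
      Complex.zero_re] at this ⊢
    linarith
  have h6 : Complex.I * ((v * starRingEnd ℂ (n t)).im : ℂ) = v * starRingEnd ℂ (n t) := by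
    conv_rhs => rw [← Complex.re_add_im (v * starRingEnd ℂ (n t)), h5]
    simp [mul_comm]
  rw [h6, mul_assoc, mul_comm (starRingEnd ℂ (n t)), h4, mul_one]

/-- Orthogonal coordinates `(s, t)` with `X_s = -i g N` and `X_t = f N`, where the unit field `N`
is so far only known to be differentiable in `s`. If `h`, the rate of rotation of `N` along the
`s`-lines, is differentiable in `t`, then `N` rotates at a continuous rate `κ` along the
`t`-lines; `f` and `κ` solve a first-order system along the `s`-lines.

The displacement `X (s₁, t) - X (s₀, t)` is differentiable in `t`, and it is `N (s₀, t)` multiplied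
by a complex factor which is differentiable in `t` and nonzero; this is why `N (s₀, t)` is
differentiable. -/
theorem exists_rotation_rate {X N : ℝ × ℝ → ℂ} {g f h k : ℝ × ℝ → ℝ} (hNc : Continuous N)
    (hgc : Continuous g) (hfc : Continuous f) (hhc : Continuous h) (hkc : Continuous k)
    {o : ℝ × ℝ} {r : ℝ} (hr : 0 < r)
    (hXs : ∀ z ∈ ball o r, HasDerivAt (fun s => X (s, z.2)) (g z • (-Complex.I * N z)) z.1)
    (hXt : ∀ z ∈ ball o r, HasDerivAt (fun t => X (z.1, t)) (f z • N z) z.2)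
    (hN : ∀ z ∈ ball o r, ‖N z‖ = 1)
    (hNs : ∀ z ∈ ball o r,
      HasDerivAt (fun s => N (s, z.2)) (-(Complex.I * (g z * h z : ℝ) * N z)) z.1)
    (hgt : ∀ z ∈ ball o r, HasDerivAt (fun t => g (z.1, t)) (h z * f z * g z) z.2)
    (hht : ∀ z ∈ ball o r, HasDerivAt (fun t => h (z.1, t)) (f z * k z) z.2) (hg0 : g o ≠ 0) :
    ∃ κ : ℝ × ℝ → ℝ, Continuous κ ∧ ∀ᶠ z in 𝓝 o,
      HasDerivAt (fun s => f (s, z.2)) (g z * κ z) z.1 ∧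
      HasDerivAt (fun s => κ (s, z.2)) (-(f z * g z * (h z ^ 2 + k z))) z.1 := by
  obtain ⟨s₀, t₀⟩ := o
  set I := Complex.I with hI
  set w : ℝ × ℝ → ℝ := fun z => f z * g z * (h z ^ 2 + k z) with hw
  have hwc : Continuous w := by fun_prop
  set E : ℝ × ℝ → ℝ := fun z => ∫ s in s₀..z.1, g (s, z.2) * h (s, z.2) with hE
  set E' : ℝ × ℝ → ℝ := fun z => ∫ s in s₀..z.1, w (s, z.2) with hE'
  have hghc : Continuous fun z => g z * h z := by fun_prop
  have hEc : Continuous E := continuous_horPrimitive hghc s₀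
  have hE'c : Continuous E' := continuous_horPrimitive hwc s₀
  have hEt : ∀ z ∈ ball (s₀, t₀) r, HasDerivAt (fun t => E (z.1, t)) (E' z) z.2 := fun z hz => by
    refine hasDerivAt_primitive_param (φ := fun z => g z * h z) (φ' := w) (o := (s₀, t₀))
      hghc hwc (fun z hz => ?_) hz
    refine ((hgt z hz).mul (hht z hz)).congr_deriv ?_
    simp only [hw]
    ring
  set e : ℝ × ℝ → ℂ := fun z => Complex.exp (-(I * (E z : ℂ))) with he
  have hec : Continuous e := by fun_prop
  have het : ∀ z ∈ ball (s₀, t₀) r,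
      HasDerivAt (fun t => e (z.1, t)) (e z * -(I * (E' z : ℂ))) z.2 := fun z hz => by
    exact ((hEt z hz).ofReal_comp.const_mul I).neg.cexp
  -- along the `s`-lines, `N` is rotated by the angle `-E`
  have hNe : ∀ z ∈ ball (s₀, t₀) r, N z = e z * N (s₀, z.2) := by
    intro z hz
    have hz' := mem_ball_prod_real.1 hz
    have hd : ∀ s ∈ ball s₀ r, HasDerivAt (fun s => Complex.exp (I * (E (s, z.2) : ℂ)) * N (s, z.2))
        0 s := by
      intro s hs
      have h1 := ((hasDerivAt_horPrimitive hghc s₀ (s, z.2)).ofReal_comp.const_mul I).cexp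
      have h2 := hNs (s, z.2) (mem_ball_prod_real.2 ⟨hs, hz'.2⟩)
      refine (h1.mul h2).congr_deriv ?_
      push_cast
      ring
    have hconst := isOpen_ball.is_const_of_deriv_eq_zero (convex_ball s₀ r).isPreconnected
      (fun x hx => (hd x hx).differentiableAt.differentiableWithinAt)
      (fun x hx => (hd x hx).deriv) hz'.1 (mem_ball_self hr)
    have hE0 : E (s₀, z.2) = 0 := by simp [hE]
    rw [hE0] at hconst
    simp only [Complex.ofReal_zero, mul_zero, Complex.exp_zero, one_mul] at hconst
    rw [← hconst, he, ← mul_assoc, ← Complex.exp_add]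
    simp
  -- the complex factor `B` relating displacements to the normal
  set b : ℝ × ℝ → ℂ := fun z => g z * e z with hb
  have hbc : Continuous b := by fun_prop
  set b' : ℝ × ℝ → ℂ := fun z =>
    (h z * f z * g z : ℝ) * e z + g z * (e z * -(I * (E' z : ℂ))) with hb'
  have hb'c : Continuous b' := by fun_prop
  have hbt : ∀ z ∈ ball (s₀, t₀) r, HasDerivAt (fun t => b (z.1, t)) (b' z) z.2 := fun z hz =>
    (hgt z hz).ofReal_comp.mul (het z hz)
  set B : ℝ × ℝ → ℂ := fun z => ∫ s in s₀..z.1, b (s, z.2) with hB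
  set B' : ℝ × ℝ → ℂ := fun z => ∫ s in s₀..z.1, b' (s, z.2) with hB'
  have hBc : Continuous B := continuous_horPrimitive hbc s₀
  have hB'c : Continuous B' := continuous_horPrimitive hb'c s₀
  have hBt : ∀ z ∈ ball (s₀, t₀) r, HasDerivAt (fun t => B (z.1, t)) (B' z) z.2 := fun z hz =>
    hasDerivAt_primitive_param (o := (s₀, t₀)) hbc hb'c hbt hz
  have hgNc : Continuous fun z => g z • (-I * N z) := by fun_prop
  have hXB : ∀ z ∈ ball (s₀, t₀) r, X z - X (s₀, z.2) = -I * B z * N (s₀, z.2) := by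
    intro z hz
    have hz' := mem_ball_prod_real.1 hz
    rw [sub_eq_horPrimitive (o := (s₀, t₀)) hgNc hXs hz, hB]
    simp only
    rw [← intervalIntegral.integral_const_mul, ← intervalIntegral.integral_mul_const]
    refine intervalIntegral.integral_congr fun s hs => ?_
    have hs' : (s, z.2) ∈ ball (s₀, t₀) r := mem_ball_prod_real.2
      ⟨(convex_ball s₀ r).ordConnected.uIcc_subset (mem_ball_self hr) hz'.1 hs, hz'.2⟩
    simp only [hb, hNe _ hs', Complex.real_smul]
    ring
  -- the factor vanishes at `s₀`, where its derivative is not zero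
  obtain ⟨s₁, hs₁, hB₁⟩ : ∃ s₁ ∈ ball s₀ r, B (s₁, t₀) ≠ 0 := by
    have h1 : HasDerivAt (fun s => B (s, t₀)) (b (s₀, t₀)) s₀ :=
      hasDerivAt_horPrimitive hbc s₀ (s₀, t₀)
    have h2 : b (s₀, t₀) ≠ 0 := by
      simp only [hb, he]
      exact mul_ne_zero (by exact_mod_cast hg0) (Complex.exp_ne_zero _)
    have h3 := h1.eventually_ne (c := 0) h2
    have h4 : ∀ᶠ s in 𝓝[≠] s₀, s ∈ ball s₀ r := nhdsWithin_le_nhds (ball_mem_nhds s₀ hr)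
    obtain ⟨s, hs⟩ := (h3.and h4).exists
    exact ⟨s, hs.2, hs.1⟩
  have hBne : ∀ᶠ t in 𝓝 t₀, B (s₁, t) ≠ 0 :=
    (by fun_prop : Continuous fun t => B (s₁, t)).continuousAt.eventually_ne hB₁
  have htr : ∀ᶠ t in 𝓝 t₀, t ∈ ball t₀ r := ball_mem_nhds t₀ hr
  -- differentiability of `N` on the `t`-line through `s₀`
  set ν₀ : ℝ → ℂ := fun t => I * ((f (s₁, t) • N (s₁, t) - f (s₀, t) • N (s₀, t)) * B (s₁, t)
    - (-I * B (s₁, t) * N (s₀, t)) * B' (s₁, t)) / B (s₁, t) ^ 2 with hν₀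
  have hν₀d : ∀ᶠ t in 𝓝 t₀, HasDerivAt (fun t => N (s₀, t)) (ν₀ t) t := by
    filter_upwards [htr, hBne, htr.eventually_nhds, hBne.eventually_nhds] with t ht hBt0 ht' hBt'
    have m1 : (s₁, t) ∈ ball (s₀, t₀) r := mem_ball_prod_real.2 ⟨hs₁, ht⟩
    have m0 : (s₀, t) ∈ ball (s₀, t₀) r := mem_ball_prod_real.2 ⟨mem_ball_self hr, ht⟩
    have hd := (((hXt (s₁, t) m1).sub (hXt (s₀, t) m0)).div (hBt (s₁, t) m1) hBt0).const_mul I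
    refine (hd.congr_of_eventuallyEq ?_).congr_deriv ?_
    · filter_upwards [ht', hBt'] with u hu hBu
      have m1' : (s₁, u) ∈ ball (s₀, t₀) r := mem_ball_prod_real.2 ⟨hs₁, hu⟩
      have e1 := hXB _ m1'
      simp only [Pi.sub_apply, Pi.div_apply] at e1 ⊢
      rw [e1]
      field_simp
      rw [hI, Complex.I_sq]
      ring
    · simp only [Pi.sub_apply, hν₀, ← hXB _ m1]
      ring
  obtain ⟨ν, hνc, hν⟩ := exists_continuous_extension_real (f := ν₀) (t₀ := t₀) (by
    filter_upwards [hBne] with t ht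
    have : B (s₁, t) ^ 2 ≠ 0 := pow_ne_zero 2 ht
    simp only [hν₀]
    fun_prop (disch := assumption))
  have hνd : ∀ᶠ t in 𝓝 t₀, HasDerivAt (fun t => N (s₀, t)) (ν t) t := by
    filter_upwards [hν₀d, hν] with t h1 h2
    rwa [h2]
  obtain ⟨r₁, hr₁, hν₁⟩ := Metric.eventually_nhds_iff_ball.1 hνd
  set κ : ℝ × ℝ → ℝ := fun z => (ν z.2 * starRingEnd ℂ (N (s₀, z.2))).im - E' z with hκ
  have hκc : Continuous κ := by
    have : Continuous fun z : ℝ × ℝ => ν z.2 * starRingEnd ℂ (N (s₀, z.2)) :=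
      (by fun_prop : Continuous fun z : ℝ × ℝ => ν z.2).mul
        (Complex.continuous_conj.comp (by fun_prop))
    exact (Complex.continuous_im.comp this).sub hE'c
  set r₂ := min r r₁ with hr₂
  have hr₂0 : 0 < r₂ := lt_min hr hr₁
  have hsub : ball (s₀, t₀) r₂ ⊆ ball (s₀, t₀) r := ball_subset_ball (min_le_left _ _)
  have hNt : ∀ z ∈ ball (s₀, t₀) r₂,
      HasDerivAt (fun t => N (z.1, t)) (I * (κ z : ℂ) * N z) z.2 := by
    intro z hz
    have hz' := mem_ball_prod_real.1 hz
    have hzr := hsub hz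
    have hd := hν₁ z.2 (ball_subset_ball (min_le_right _ _) hz'.2)
    have hnear : ∀ᶠ t in 𝓝 z.2, (z.1, t) ∈ ball (s₀, t₀) r :=
      (Continuous.prodMk_right z.1).continuousAt.preimage_mem_nhds (isOpen_ball.mem_nhds hzr)
    have hnear' : ∀ᶠ t in 𝓝 z.2, t ∈ ball t₀ r :=
      isOpen_ball.mem_nhds (mem_ball_prod_real.1 hzr).2
    have hv := eq_I_mul_of_hasDerivAt_unit (n := fun t => N (s₀, t)) (by
      filter_upwards [hnear'] with t ht
      exact hN _ (mem_ball_prod_real.2 ⟨mem_ball_self hr, ht⟩)) hd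
    refine (((het z hzr).mul hd).congr_of_eventuallyEq ?_).congr_deriv ?_
    · filter_upwards [hnear] with t ht using hNe _ ht
    · rw [hNe z hzr]
      simp only [hκ]
      push_cast
      linear_combination e z * hv
  refine ⟨κ, hκc, ?_⟩
  filter_upwards [ball_mem_nhds (s₀, t₀) hr₂0] with z hz
  refine ⟨?_, ?_⟩
  · -- exchange the order of differentiation of `X`
    set ψ : ℝ × ℝ → ℂ := fun z => ((g z * κ z : ℝ) - I * (h z * f z * g z : ℝ)) * N z with hψ
    have hψc : Continuous ψ := by fun_prop
    have hmix : ∀ z ∈ ball (s₀, t₀) r₂,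
        f z • N z - f (s₀, z.2) • N (s₀, z.2) = ∫ s in s₀..z.1, ψ (s, z.2) := by
      intro z hz
      have hz' := mem_ball_prod_real.1 hz
      have h0 : (s₀, z.2) ∈ ball (s₀, t₀) r :=
        hsub (mem_ball_prod_real.2 ⟨mem_ball_self hr₂0, hz'.2⟩)
      have h1 := hasDerivAt_primitive_param (o := (s₀, t₀)) (r := r₂) hgNc hψc (fun z hz => by
        refine ((hgt z (hsub hz)).smul ((hNt z hz).const_mul (-I))).congr_deriv ?_
        simp only [hψ, Complex.real_smul, Prod.mk.eta]
        push_cast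
        linear_combination (-(g z : ℂ) * κ z * N z) * (by rw [hI, Complex.I_sq] : I ^ 2 = -1)) hz
      refine ((hXt z (hsub hz)).sub (hXt (s₀, z.2) h0)).unique (h1.congr_of_eventuallyEq ?_)
      have hnear : ∀ᶠ t in 𝓝 z.2, (z.1, t) ∈ ball (s₀, t₀) r :=
        (Continuous.prodMk_right z.1).continuousAt.preimage_mem_nhds
          (isOpen_ball.mem_nhds (hsub hz))
      filter_upwards [hnear] with t ht
      exact sub_eq_horPrimitive (o := (s₀, t₀)) hgNc hXs ht
    have hnear : ∀ᶠ s in 𝓝 z.1, (s, z.2) ∈ ball (s₀, t₀) r₂ :=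
      (Continuous.prodMk_left z.2).continuousAt.preimage_mem_nhds (isOpen_ball.mem_nhds hz)
    have hfN : HasDerivAt (fun s => f (s, z.2) • N (s, z.2)) (ψ z) z.1 := by
      refine ((hasDerivAt_horPrimitive hψc s₀ z).add_const
        (f (s₀, z.2) • N (s₀, z.2))).congr_of_eventuallyEq ?_
      filter_upwards [hnear] with s hs
      rw [← hmix _ hs]
      simp
    have hunit : ∀ z ∈ ball (s₀, t₀) r, N z * starRingEnd ℂ (N z) = 1 := fun z hz => by
      rw [Complex.mul_conj, Complex.normSq_eq_norm_sq, hN z hz]; simp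
    have hff : HasDerivAt (fun s => (f (s, z.2) : ℂ)) ((g z * κ z : ℝ) : ℂ) z.1 := by
      refine ((hfN.mul (hNs z (hsub hz)).star).congr_of_eventuallyEq ?_).congr_deriv ?_
      · filter_upwards [hnear] with s hs
        have := hunit _ (hsub hs)
        simp only [Pi.mul_apply, Complex.real_smul, Complex.star_def, mul_assoc, this, mul_one]
      · have := hunit _ (hsub hz)
        simp only [hψ, Complex.real_smul, Complex.star_def, map_neg, map_mul,
          Complex.conj_ofReal, Prod.mk.eta]
        rw [hI, Complex.conj_I]
        push_cast
        linear_combination ((g z : ℂ) * κ z) * this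
    have := Complex.reCLM.hasFDerivAt.comp_hasDerivAt z.1 hff
    simpa using! this
  · exact (hasDerivAt_horPrimitive hwc s₀ z).const_sub
      (ν z.2 * starRingEnd ℂ (N (s₀, z.2))).im

/-! ### Existence of orthogonal coordinates -/

/-- Orthogonal coordinates `S = (s, t)` near `p`, with local inverse `Y`, adapted to a unit field
`(n₁, n₂)`: the `s`-lines follow the rotated field `(n₂, -n₁)` with speed `g`, the `t`-lines follow
`(n₁, n₂)` with speed `f`. The last two fields are the equations
`div (n₁, n₂) = H` and `curl (D n₁, D n₂) = c` in these coordinates. The functions `Y`, `f`, `g`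
are continuous on the whole plane, but describe the coordinates only near `S p`. -/
structure IsOrthogonalChart (n₁ n₂ D c H : ℝ × ℝ → ℝ) (p : ℝ × ℝ) (S Y : ℝ × ℝ → ℝ × ℝ)
    (f g : ℝ × ℝ → ℝ) : Prop where
  continuous_symm : Continuous Y
  continuous_f : Continuous f
  continuous_g : Continuous g
  left_inv : ∀ᶠ q in 𝓝 p, Y (S q) = q
  right_inv : ∀ᶠ z in 𝓝 (S p), S (Y z) = z
  f_pos : ∀ᶠ z in 𝓝 (S p), 0 < f z
  g_pos : ∀ᶠ z in 𝓝 (S p), 0 < g z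
  hasFDerivAt : ∀ᶠ q in 𝓝 p, HasFDerivAt S
    ((form ((g (S q))⁻¹ * n₂ q) (-((g (S q))⁻¹ * n₁ q))).prod
      (form ((f (S q))⁻¹ * n₁ q) ((f (S q))⁻¹ * n₂ q))) q
  hasDerivAt_fst : ∀ᶠ z in 𝓝 (S p),
    HasDerivAt (fun s => Y (s, z.2)) (g z • (n₂ (Y z), -n₁ (Y z))) z.1
  hasDerivAt_snd : ∀ᶠ z in 𝓝 (S p),
    HasDerivAt (fun t => Y (z.1, t)) (f z • (n₁ (Y z), n₂ (Y z))) z.2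
  hasDerivAt_g : ∀ᶠ z in 𝓝 (S p),
    HasDerivAt (fun t => g (z.1, t)) (H (Y z) * f z * g z) z.2
  hasDerivAt_D_mul_f : ∀ᶠ z in 𝓝 (S p),
    HasDerivAt (fun s => D (Y (s, z.2)) * f (s, z.2)) (c (Y z) * f z * g z) z.1

theorem eventually_prodMk_left {P : ℝ × ℝ → Prop} {z : ℝ × ℝ} (h : ∀ᶠ z' in 𝓝 z, P z') :
    ∀ᶠ s in 𝓝 z.1, P (s, z.2) :=
  ((Continuous.prodMk_left z.2).tendsto z.1).eventually h

theorem eventually_prodMk_right {P : ℝ × ℝ → Prop} {z : ℝ × ℝ} (h : ∀ᶠ z' in 𝓝 z, P z') :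
    ∀ᶠ t in 𝓝 z.2, P (z.1, t) :=
  ((Continuous.prodMk_right z.1).tendsto z.2).eventually h

/-- The coordinates are the potentials of `m₂ (n₂, -n₁)` and `m₁ D (n₁, n₂)` for two integrating
factors; the equations for `g = 1 / m₂` and `D f = 1 / m₁` are those of the integrating factors. -/
theorem exists_isOrthogonalChart {n₁ n₂ D c H : ℝ × ℝ → ℝ} (h₁ : Continuous n₁)
    (h₂ : Continuous n₂) (hD : Continuous D) (hc : Continuous c) (hH : Continuous H)
    {p : ℝ × ℝ} {r : ℝ} (hr : 0 < r) (hunit : ∀ q ∈ ball p r, n₁ q ^ 2 + n₂ q ^ 2 = 1)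
    (hDpos : ∀ q ∈ ball p r, 0 < D q)
    (hcurl : HasCirculation (fun q => D q * n₁ q) (fun q => D q * n₂ q) c (ball p r))
    (hdiv : HasCirculation n₂ (fun q => -n₁ q) (fun q => -H q) (ball p r)) :
    ∃ S Y f g, IsOrthogonalChart n₁ n₂ D c H p S Y f g := by
  have hup := hunit p (mem_ball_self hr)
  have hDp := hDpos p (mem_ball_self hr)
  obtain ⟨τ, m₁, hτ, hm₁c, hm₁, hm₁d⟩ := hcurl.exists_integratingFactor (hD.mul h₁) (hD.mul h₂) hc
    hr (by
      by_contra! h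
      have a1 : n₁ p = 0 := by simpa [hDp.ne'] using h.1
      have a2 : n₂ p = 0 := by simpa [hDp.ne'] using h.2
      simp [a1, a2] at hup)
  obtain ⟨σ, m₂, hσ, hm₂c, hm₂, hm₂d⟩ := hdiv.exists_integratingFactor h₂ h₁.neg hH.neg hr (by
      by_contra! h
      simp [neg_eq_zero.1 h.2, h.1] at hup)
  set S : ℝ × ℝ → ℝ × ℝ := fun q => (σ q, τ q) with hS
  have hSd : ∀ᶠ q in 𝓝 p, HasFDerivAt S ((form (m₂ q * n₂ q) (m₂ q * -n₁ q)).prod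
      (form (m₁ q * (D q * n₁ q)) (m₁ q * (D q * n₂ q)))) q := by
    filter_upwards [hσ, hτ] with q hq1 hq2 using hq1.prodMk hq2
  have hσ1 : ContDiffAt ℝ 1 σ p := contDiffAt_of_eventually_hasFDerivAt_form hσ
    (hm₂c.mono fun q hq => hq.mul h₂.continuousAt)
    (hm₂c.mono fun q hq => hq.mul h₁.neg.continuousAt)
  have hτ1 : ContDiffAt ℝ 1 τ p := contDiffAt_of_eventually_hasFDerivAt_form hτ
    (hm₁c.mono fun q hq => hq.mul (hD.mul h₁).continuousAt)
    (hm₁c.mono fun q hq => hq.mul (hD.mul h₂).continuousAt)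
  have hinj : ∀ {q : ℝ × ℝ} {v : ℝ × ℝ}, q ∈ ball p r → 0 < m₁ q → 0 < m₂ q →
      ((form (m₂ q * n₂ q) (m₂ q * -n₁ q)).prod
        (form (m₁ q * (D q * n₁ q)) (m₁ q * (D q * n₂ q)))) v = 0 → v = 0 := by
    intro q v hq hp1 hp2 hv
    have hu := hunit q hq
    have hDq := hDpos q hq
    simp only [ContinuousLinearMap.prod_apply, form_apply, smul_eq_mul, Prod.mk_eq_zero] at hv
    have e1 : v.1 * n₂ q - v.2 * n₁ q = 0 := by
      have : m₂ q * (v.1 * n₂ q - v.2 * n₁ q) = 0 := by linear_combination hv.1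
      simpa [hp2.ne'] using this
    have e2 : v.1 * n₁ q + v.2 * n₂ q = 0 := by
      have : m₁ q * D q * (v.1 * n₁ q + v.2 * n₂ q) = 0 := by linear_combination hv.2
      simpa [hp1.ne', hDq.ne'] using this
    ext
    · simp only [Prod.fst_zero]
      linear_combination n₂ q * e1 + n₁ q * e2 - v.1 * hu
    · simp only [Prod.snd_zero]
      linear_combination n₂ q * e2 - n₁ q * e1 - v.2 * hu
  have hS1 : ContDiffAt ℝ 1 S p := hσ1.prodMk hτ1
  obtain ⟨Y₀, hY₀1, hY₀p, hYS, hSY⟩ := exists_local_inverse hS1 hSd.self_of_nhds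
    fun v hv => hinj (mem_ball_self hr) hm₁.self_of_nhds hm₂.self_of_nhds hv
  obtain ⟨Y, hYc, hYe⟩ := exists_continuous_extension (ContDiffAt.eventually_continuousAt hY₀1)
  have hYp : Y (S p) = p := by rw [hYe.self_of_nhds, hY₀p]
  have hYt : Tendsto Y (𝓝 (S p)) (𝓝 p) := by
    have := hYc.tendsto (S p)
    rwa [hYp] at this
  have hSt : Tendsto S (𝓝 p) (𝓝 (S p)) := hS1.continuousAt
  have hball : ∀ᶠ q in 𝓝 p, q ∈ ball p r := ball_mem_nhds p hr
  obtain ⟨g, hgc, hge⟩ := exists_continuous_extension (f := fun z => (m₂ (Y z))⁻¹) (p := S p) (by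
    filter_upwards [hYt.eventually hm₂c, hYt.eventually hm₂] with z hz1 hz2
    exact (ContinuousAt.comp hz1 hYc.continuousAt).inv₀ hz2.ne')
  obtain ⟨f, hfc, hfe⟩ := exists_continuous_extension (f := fun z => (m₁ (Y z) * D (Y z))⁻¹)
    (p := S p) (by
      filter_upwards [hYt.eventually hm₁c, hYt.eventually hm₁, hYt.eventually hball]
        with z hz1 hz2 hz3
      exact ((ContinuousAt.comp hz1 hYc.continuousAt).mul (hD.comp hYc).continuousAt).inv₀
        (mul_pos hz2 (hDpos _ hz3)).ne')
  have hgpos : ∀ᶠ z in 𝓝 (S p), 0 < g z := by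
    filter_upwards [hge, hYt.eventually hm₂] with z hz1 hz2
    rw [hz1]; exact inv_pos.2 hz2
  have hfpos : ∀ᶠ z in 𝓝 (S p), 0 < f z := by
    filter_upwards [hfe, hYt.eventually hm₁, hYt.eventually hball] with z hz1 hz2 hz3
    rw [hz1]; exact inv_pos.2 (mul_pos hz2 (hDpos _ hz3))
  have hYS' : ∀ᶠ q in 𝓝 p, Y (S q) = q := by
    filter_upwards [hYS, hSt.eventually hYe] with q hq1 hq2
    rw [hq2, hq1]
  have hSY' : ∀ᶠ z in 𝓝 (S p), S (Y z) = z := by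
    filter_upwards [hSY, hYe] with z hz1 hz2
    rw [hz2, hz1]
  have hYd : ∀ᶠ z in 𝓝 (S p), HasFDerivAt Y
      (form (g z • (n₂ (Y z), -n₁ (Y z))) (f z • (n₁ (Y z), n₂ (Y z)))) z := by
    filter_upwards [hY₀1.eventually (by simp), hYe.eventually_nhds, hSY'.eventually_nhds,
      hYt.eventually hSd, hYt.eventually hm₁, hYt.eventually hm₂, hYt.eventually hball, hge, hfe]
      with z z1 z2 z3 z4 z5 z6 z7 z8 z9
    have hL := ((z1.differentiableAt one_ne_zero).hasFDerivAt).congr_of_eventuallyEq z2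
    set L := fderiv ℝ Y₀ z
    have huniq := ((z4.comp z hL).congr_of_eventuallyEq (f₁ := id)
      (z3.mono fun z' hz' => hz'.symm)).unique (hasFDerivAt_id z)
    refine hL.congr_fderiv (ContinuousLinearMap.ext fun v => ?_)
    rw [← sub_eq_zero]
    refine hinj z7 z5 z6 ?_
    have e := congrArg (fun A => A v) huniq
    simp only [ContinuousLinearMap.comp_apply, ContinuousLinearMap.id_apply] at e
    have hu := hunit _ z7
    have hDz := (hDpos _ z7).ne'
    have h5 := z5.ne'
    have h6 := z6.ne'
    rw [map_sub, e, sub_eq_zero, z8, z9]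
    ext
    · simp only [ContinuousLinearMap.prod_apply, form_apply, smul_eq_mul, Prod.smul_mk,
        Prod.mk_add_mk]
      field_simp
      linear_combination -v.1 * m₁ (Y z) * D (Y z) * hu
    · simp only [ContinuousLinearMap.prod_apply, form_apply, smul_eq_mul, Prod.smul_mk,
        Prod.mk_add_mk]
      field_simp
      linear_combination -v.2 * m₂ (Y z) * hu
  have hYs : ∀ᶠ z in 𝓝 (S p),
      HasDerivAt (fun s => Y (s, z.2)) (g z • (n₂ (Y z), -n₁ (Y z))) z.1 :=
    hYd.mono fun z hz => hasFDerivAt_form_partial_fst hz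
  have hYtt : ∀ᶠ z in 𝓝 (S p),
      HasDerivAt (fun t => Y (z.1, t)) (f z • (n₁ (Y z), n₂ (Y z))) z.2 :=
    hYd.mono fun z hz => hasFDerivAt_form_partial_snd hz
  refine ⟨S, Y, f, g, hYc, hfc, hgc, hYS', hSY', hfpos, hgpos, ?_, hYs, hYtt, ?_, ?_⟩
  · filter_upwards [hSd, hYS', hSt.eventually hge, hSt.eventually hfe] with q q1 q2 q3 q4
    rw [q3, q4, q2, inv_inv, inv_inv]
    refine q1.congr_fderiv ?_
    simp only [mul_assoc, mul_neg]
  · filter_upwards [hYt.eventually hm₂d, hYt.eventually hm₂, hge.eventually_nhds,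
      hYtt.eventually_nhds, hfpos] with z z1 z2 z3 z4 z5
    have hd := DerivAlong.hasDerivAt_reparam (x := fun t => Y (z.1, t)) (t₀ := z.2)
      (f := fun t => -f (z.1, t)) z1
      (Eventually.of_forall fun t => (by fun_prop : Continuous fun t => -f (z.1, t)).continuousAt)
      (by simpa using z5.ne') (by
        filter_upwards [eventually_prodMk_right z4] with t ht
        refine ht.congr_deriv ?_
        simp)
    have hi := hd.inv z2.ne'
    refine (hi.congr_of_eventuallyEq ?_).congr_deriv ?_
    · filter_upwards [eventually_prodMk_right z3] with t ht using ht
    · rw [z3.self_of_nhds]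
      have := z2.ne'
      simp only [smul_eq_mul, Prod.mk.eta, Pi.neg_apply]
      field_simp
  · filter_upwards [hYt.eventually hm₁d, hYt.eventually hm₁, hfe.eventually_nhds,
      hYs.eventually_nhds, hgpos, (hYt.eventually hball).eventually_nhds] with z z1 z2 z3 z4 z5 z6
    have hDz := (hDpos _ z6.self_of_nhds).ne'
    have hd := DerivAlong.hasDerivAt_reparam (x := fun s => Y (s, z.2)) (t₀ := z.1)
      (f := fun s => g (s, z.2) / D (Y (s, z.2))) z1
      (by
        filter_upwards [eventually_prodMk_left z6] with s hs
        exact (by fun_prop : Continuous fun s => g (s, z.2)).continuousAt.div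
          (by fun_prop : Continuous fun s => D (Y (s, z.2))).continuousAt (hDpos _ hs).ne')
      (div_ne_zero z5.ne' hDz) (by
        filter_upwards [eventually_prodMk_left z4, eventually_prodMk_left z6] with s hs hs'
        refine hs.congr_deriv ?_
        have := (hDpos _ hs').ne'
        ext <;> simp <;> field_simp)
    have hi := hd.inv z2.ne'
    refine (hi.congr_of_eventuallyEq ?_).congr_deriv ?_
    · filter_upwards [eventually_prodMk_left z3, eventually_prodMk_left z6] with s hs hs'
      have := (hDpos _ hs').ne'
      simp only [hs, Pi.inv_apply]
      field_simp
    · rw [z3.self_of_nhds]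
      have := z2.ne'
      simp only [smul_eq_mul, Prod.mk.eta]
      field_simp

namespace IsOrthogonalChart

variable {n₁ n₂ D c H : ℝ × ℝ → ℝ} {p : ℝ × ℝ} {S Y : ℝ × ℝ → ℝ × ℝ} {f g : ℝ × ℝ → ℝ}

theorem tendsto (hS : IsOrthogonalChart n₁ n₂ D c H p S Y f g) : Tendsto S (𝓝 p) (𝓝 (S p)) :=
  hS.hasFDerivAt.self_of_nhds.continuousAt

theorem tendsto_symm (hS : IsOrthogonalChart n₁ n₂ D c H p S Y f g) :
    Tendsto Y (𝓝 (S p)) (𝓝 p) := by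
  have := hS.continuous_symm.tendsto (S p)
  rwa [hS.left_inv.self_of_nhds] at this

theorem hasDerivAt_comp_fst (hS : IsOrthogonalChart n₁ n₂ D c H p S Y f g) :
    ∀ᶠ z in 𝓝 (S p), ∀ (h : ℝ × ℝ → ℝ) (k : ℝ), DerivAlong (fun q => (n₂ q, -n₁ q)) h k (Y z) →
      HasDerivAt (fun s => h (Y (s, z.2))) (g z * k) z.1 := by
  filter_upwards [hS.g_pos, hS.hasDerivAt_fst.eventually_nhds] with z z1 z2 h k hk
  have hg := hS.continuous_g
  exact DerivAlong.hasDerivAt_reparam (x := fun s => Y (s, z.2)) (t₀ := z.1)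
    (f := fun s => g (s, z.2)) hk (Eventually.of_forall fun s =>
      (by fun_prop : Continuous fun s => g (s, z.2)).continuousAt) z1.ne'
    (eventually_prodMk_left z2)

theorem hasDerivAt_comp_snd (hS : IsOrthogonalChart n₁ n₂ D c H p S Y f g) :
    ∀ᶠ z in 𝓝 (S p), ∀ (h : ℝ × ℝ → ℝ) (k : ℝ), DerivAlong (fun q => (n₁ q, n₂ q)) h k (Y z) →
      HasDerivAt (fun t => h (Y (z.1, t))) (f z * k) z.2 := by
  filter_upwards [hS.f_pos, hS.hasDerivAt_snd.eventually_nhds] with z z1 z2 h k hk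
  have hf := hS.continuous_f
  exact DerivAlong.hasDerivAt_reparam (x := fun t => Y (z.1, t)) (t₀ := z.2)
    (f := fun t => f (z.1, t)) hk (Eventually.of_forall fun s =>
      (by fun_prop : Continuous fun t => f (z.1, t)).continuousAt) z1.ne'
    (eventually_prodMk_right z2)

/-- Integral curves of the rotated field are `s`-lines, so derivatives along the rotated field can
be computed in the coordinates. -/
theorem derivAlong (hS : IsOrthogonalChart n₁ n₂ D c H p S Y f g)
    (hunit : ∀ᶠ q in 𝓝 p, n₁ q ^ 2 + n₂ q ^ 2 = 1) :
    ∀ᶠ q in 𝓝 p, ∀ (h : ℝ × ℝ → ℝ) (k : ℝ),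
      HasDerivAt (fun s => h (Y (s, (S q).2))) (g (S q) * k) (S q).1 →
        DerivAlong (fun q => (n₂ q, -n₁ q)) h k q := by
  filter_upwards [hS.left_inv.eventually_nhds, hS.hasFDerivAt.eventually_nhds,
    hunit.eventually_nhds, hS.tendsto.eventually hS.g_pos] with q q1 q2 q3 q4 h k hk γ hγ0 hγ
  have hγt : Tendsto γ (𝓝 0) (𝓝 q) := hγ0 ▸ hγ.self_of_nhds.continuousAt.tendsto
  have hSγ : ∀ᶠ t in 𝓝 0, HasDerivAt (fun t => S (γ t)) ((g (S (γ t)))⁻¹, 0) t := by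
    filter_upwards [hγ, hγt.eventually q2, hγt.eventually q3] with t t1 t2 t3
    refine (t2.comp_hasDerivAt t t1).congr_deriv ?_
    ext
    · simp only [ContinuousLinearMap.prod_apply, form_apply, smul_eq_mul]
      linear_combination (g (S (γ t)))⁻¹ * t3
    · simp only [ContinuousLinearMap.prod_apply, form_apply, smul_eq_mul]
      ring
  have hconst : ∀ᶠ t in 𝓝 0, (S (γ t)).2 = (S (γ 0)).2 :=
    eventually_eq_of_hasDerivAt_zero (f := fun t => (S (γ t)).2) (hSγ.mono fun t ht => ht.snd)
  rw [hγ0] at hconst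
  have h1 : HasDerivAt (fun t => (S (γ t)).1) (g (S q))⁻¹ 0 := by
    have := hSγ.self_of_nhds.fst
    rwa [hγ0] at this
  have h2 := hk.comp_of_eq (0 : ℝ) h1 (by rw [hγ0])
  refine (h2.congr_of_eventuallyEq ?_).congr_deriv ?_
  · filter_upwards [hconst, hγt.eventually q1] with t t1 t2
    simp only [Function.comp_apply]
    rw [← t1, Prod.mk.eta, t2]
  · field_simp

theorem exists_integralCurve (hS : IsOrthogonalChart n₁ n₂ D c H p S Y f g) :
    ∀ᶠ q in 𝓝 p, ∃ γ : ℝ → ℝ × ℝ, γ 0 = q ∧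
      ∀ᶠ t in 𝓝 0, HasDerivAt γ (n₂ (γ t), -n₁ (γ t)) t := by
  filter_upwards [hS.tendsto.eventually hS.g_pos, hS.tendsto.eventually
    hS.hasDerivAt_fst.eventually_nhds, hS.left_inv] with q q1 q2 q3
  have hg := hS.continuous_g
  obtain ⟨γ, -, hγ0, hγ, -⟩ := exists_integralCurve_reparam (X := fun q => (n₂ q, -n₁ q))
    (x := fun s => Y (s, (S q).2)) (t₀ := (S q).1) (f := fun s => g (s, (S q).2))
    (Eventually.of_forall fun s =>
      (by fun_prop : Continuous fun s => g (s, (S q).2)).continuousAt) q1.ne'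
    (eventually_prodMk_left q2)
  exact ⟨γ, by rw [hγ0, Prod.mk.eta, q3], hγ⟩

end IsOrthogonalChart

/-! ### The second derivative in the square -/

/-- The system `(D f)_s = c f g`, `f_s = g κ`, `κ_s = -f g M` along an `s`-line determines the first
and the second derivative of `D` with respect to arc length, `g⁻¹ ∂_s`. -/
theorem hasDerivAt_quotient_system {D f g κ c d₁ : ℝ → ℝ} {c' M s : ℝ}
    (hDf : ∀ᶠ x in 𝓝 s, HasDerivAt (fun x => D x * f x) (c x * f x * g x) x)
    (hf : ∀ᶠ x in 𝓝 s, HasDerivAt f (g x * κ x) x)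
    (hκ : HasDerivAt κ (-(f s * g s * M)) s) (hc : HasDerivAt c (g s * c') s)
    (hpos : ∀ᶠ x in 𝓝 s, 0 < f x) (hd : ∀ᶠ x in 𝓝 s, d₁ x = c x - D x * κ x / f x) :
    HasDerivAt D (g s * d₁ s) s ∧ HasDerivAt d₁
      (g s * (c' - d₁ s * κ s / f s + D s * M + D s * (κ s / f s) ^ 2)) s := by
  have hD : HasDerivAt D (g s * d₁ s) s := by
    have hfs := hpos.self_of_nhds.ne'
    refine ((hDf.self_of_nhds.div hf.self_of_nhds hfs).congr_of_eventuallyEq ?_).congr_deriv ?_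
    · filter_upwards [hpos] with x hx
      simp [hx.ne']
    · rw [hd.self_of_nhds]
      field_simp
  refine ⟨hD, ?_⟩
  have hfs := hpos.self_of_nhds.ne'
  refine ((hc.sub ((hD.mul hκ).div hf.self_of_nhds hfs)).congr_of_eventuallyEq hd).congr_deriv ?_
  simp only [Pi.mul_apply]
  field_simp
  ring

/-- The theorem for a unit field `(n₁, n₂)` with divergence `H` such that `D (n₁, n₂)` has curl `c`,
near the centre of a square. -/
theorem exists_second_derivAlong {n₁ n₂ D c H c' k : ℝ × ℝ → ℝ} (h₁ : Continuous n₁)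
    (h₂ : Continuous n₂) (hD : Continuous D) (hc : Continuous c) (hH : Continuous H)
    (hc'c : Continuous c') (hkc : Continuous k)
    {p : ℝ × ℝ} {r : ℝ} (hr : 0 < r) (hunit : ∀ q ∈ ball p r, n₁ q ^ 2 + n₂ q ^ 2 = 1)
    (hDpos : ∀ q ∈ ball p r, 0 < D q)
    (hcurl : HasCirculation (fun q => D q * n₁ q) (fun q => D q * n₂ q) c (ball p r))
    (hdiv : HasCirculation n₂ (fun q => -n₁ q) (fun q => -H q) (ball p r))
    (hc' : ∀ q ∈ ball p r, DerivAlong (fun q => (n₂ q, -n₁ q)) c (c' q) q)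
    (hk : ∀ q ∈ ball p r, DerivAlong (fun q => (n₁ q, n₂ q)) H (k q) q) :
    ∃ D₁ D₂ : ℝ × ℝ → ℝ, ∀ᶠ q in 𝓝 p, ContinuousAt D₁ q ∧ ContinuousAt D₂ q ∧
      DerivAlong (fun q => (n₂ q, -n₁ q)) D (D₁ q) q ∧
      DerivAlong (fun q => (n₂ q, -n₁ q)) D₁ (D₂ q) q ∧
      D q * D₂ q = 2 * (D₁ q - c q / 2) * (D₁ q - c q) + c' q * D q
        + (H q ^ 2 + k q) * D q ^ 2 ∧
      ∃ γ : ℝ → ℝ × ℝ, γ 0 = q ∧ ∀ᶠ t in 𝓝 0, HasDerivAt γ (n₂ (γ t), -n₁ (γ t)) t := by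
  obtain ⟨S, Y, f, g, hS⟩ := exists_isOrthogonalChart h₁ h₂ hD hc hH hr hunit hDpos hcurl hdiv
  have hYc := hS.continuous_symm
  have hfc := hS.continuous_f
  have hgc := hS.continuous_g
  have hball : ∀ᶠ q in 𝓝 p, q ∈ ball p r := ball_mem_nhds p hr
  have hunit' : ∀ q ∈ ball p r, n₂ q ^ 2 + (-n₁ q) ^ 2 = 1 := fun q hq => by
    linear_combination hunit q hq
  have hd₂ : ∀ q ∈ ball p r, DerivAlong (fun q => (n₂ q, -n₁ q)) n₂ (-(H q * n₁ q)) q :=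
    fun q hq => by
      have := hdiv.derivAlong_fst h₂ h₁.neg hH.neg hunit' hq
      simpa using this
  have hd₁ : ∀ q ∈ ball p r, DerivAlong (fun q => (n₂ q, -n₁ q)) n₁ (H q * n₂ q) q :=
    fun q hq γ h0 hγ => by
      have := (hdiv.derivAlong_snd h₂ h₁.neg hH.neg hunit' hq γ h0 hγ).neg
      exact (this.congr_of_eventuallyEq (.of_forall fun t => by simp)).congr_deriv (by simp)
  -- in complex notation the rotated field is `-i N`, and it turns at the rate `-H`
  set X : ℝ × ℝ → ℂ := fun z => Complex.equivRealProdCLM.symm (Y z) with hX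
  set N : ℝ × ℝ → ℂ := fun z => Complex.equivRealProdCLM.symm (n₁ (Y z), n₂ (Y z)) with hN
  have hcplx : ∀ {φ : ℝ → ℝ × ℝ} {v : ℝ × ℝ} {x : ℝ}, HasDerivAt φ v x →
      HasDerivAt (fun x => Complex.equivRealProdCLM.symm (φ x))
        (Complex.equivRealProdCLM.symm v) x := fun {φ v x} h =>
    (Complex.equivRealProdCLM.symm.toContinuousLinearMap.hasFDerivAt (x := φ x)).comp_hasDerivAt x h
  have hev : ∀ᶠ z in 𝓝 (S p), Y z ∈ ball p r := hS.tendsto_symm.eventually hball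
  obtain ⟨ε, hε, hεS⟩ := Metric.eventually_nhds_iff_ball.1
    (hev.and (hS.hasDerivAt_fst.and (hS.hasDerivAt_snd.and (hS.hasDerivAt_comp_fst.and
      (hS.hasDerivAt_comp_snd.and hS.hasDerivAt_g)))))
  obtain ⟨κ, hκc, hκ⟩ := exists_rotation_rate (X := X) (N := N) (g := g) (f := f)
    (h := fun z => H (Y z)) (k := fun z => k (Y z)) (by fun_prop) hgc hfc (by fun_prop)
    (by fun_prop) (o := S p) hε
    (fun z hz => (hcplx (hεS z hz).2.1).congr_deriv (by
      apply Complex.ext <;> simp [hN]))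
    (fun z hz => (hcplx (hεS z hz).2.2.1).congr_deriv (by
      apply Complex.ext <;> simp [hN]))
    (fun z hz => by
      have := hunit _ (hεS z hz).1
      rw [Complex.norm_def, Real.sqrt_eq_one, Complex.normSq_apply]
      simp only [hN, Complex.equivRealProdCLM_symm_apply_re,
        Complex.equivRealProdCLM_symm_apply_im]
      linear_combination this)
    (fun z hz => by
      have e1 := (hεS z hz).2.2.2.1 _ _ (hd₁ _ (hεS z hz).1)
      have e2 := (hεS z hz).2.2.2.1 _ _ (hd₂ _ (hεS z hz).1)
      refine (hcplx (e1.prodMk e2)).congr_deriv ?_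
      apply Complex.ext <;> simp [hN] <;> ring)
    (fun z hz => (hεS z hz).2.2.2.2.2)
    (fun z hz => (hεS z hz).2.2.2.2.1 _ _ (hk _ (hεS z hz).1))
    hS.g_pos.self_of_nhds.ne'
  -- the values dictated by `hasDerivAt_quotient_system`, with `M = H ^ 2 + k`
  set D₁ : ℝ × ℝ → ℝ := fun q => c q - D q * κ (S q) / f (S q) with hD₁
  set D₂ : ℝ × ℝ → ℝ := fun q => c' q - D₁ q * κ (S q) / f (S q) + D q * (H q ^ 2 + k q)
    + D q * (κ (S q) / f (S q)) ^ 2 with hD₂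
  refine ⟨D₁, D₂, ?_⟩
  have hSc : ∀ᶠ q in 𝓝 p, ContinuousAt S q := hS.hasFDerivAt.mono fun q hq => hq.continuousAt
  have hsys : ∀ᶠ z in 𝓝 (S p), HasDerivAt (fun s => D (Y (s, z.2))) (g z * D₁ (Y z)) z.1 ∧
      HasDerivAt (fun s => D₁ (Y (s, z.2))) (g z * D₂ (Y z)) z.1 := by
    filter_upwards [hS.hasDerivAt_D_mul_f.eventually_nhds, hκ.eventually_nhds,
      hS.f_pos.eventually_nhds, hS.right_inv.eventually_nhds, hS.hasDerivAt_comp_fst, hev]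
      with z z1 z2 z3 z4 z5 z6
    have := hasDerivAt_quotient_system (D := fun s => D (Y (s, z.2))) (f := fun s => f (s, z.2))
      (g := fun s => g (s, z.2)) (κ := fun s => κ (s, z.2)) (c := fun s => c (Y (s, z.2)))
      (d₁ := fun s => D₁ (Y (s, z.2))) (M := H (Y z) ^ 2 + k (Y z)) (s := z.1)
      (eventually_prodMk_left z1) ((eventually_prodMk_left z2).mono fun x hx => hx.1)
      z2.self_of_nhds.2 (z5 _ _ (hc' _ z6)) (eventually_prodMk_left z3)
      ((eventually_prodMk_left z4).mono fun x hx => by simp only [hD₁, hx])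
    simpa only [hD₂, z4.self_of_nhds, Prod.mk.eta] using this
  filter_upwards [hS.tendsto.eventually hsys, hS.left_inv, hS.derivAlong (hball.mono hunit),
    hS.exists_integralCurve, hSc, hS.tendsto.eventually hS.f_pos] with q q1 q2 q3 q4 q5 q6
  have hκS : ContinuousAt (fun q => κ (S q)) q := hκc.continuousAt.comp q5
  have hfS : ContinuousAt (fun q => f (S q)) q := hfc.continuousAt.comp q5
  have hD₁c : ContinuousAt D₁ q :=
    hc.continuousAt.sub ((hD.continuousAt.mul hκS).div hfS q6.ne')
  rw [q2] at q1
  refine ⟨hD₁c, ?_, q3 _ _ q1.1, q3 _ _ q1.2, ?_, q4⟩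
  · exact ((hc'c.continuousAt.sub ((hD₁c.mul hκS).div hfS q6.ne')).add
      (hD.continuousAt.mul ((hH.pow 2).add hkc).continuousAt)).add
      (hD.continuousAt.mul ((hκS.div hfS q6.ne').pow 2))
  · simp only [hD₂, hD₁]
    field_simp
    ring

/-! ### Transfer to the Euclidean plane -/

/-- The identification of `ℝ × ℝ` (with the sup norm, so that balls are squares) with the
Euclidean plane. -/
noncomputable def planeEquiv : (ℝ × ℝ) ≃L[ℝ] Plane :=
  (ContinuousLinearEquiv.finTwoArrow ℝ ℝ).symm.trans (EuclideanSpace.equiv (Fin 2) ℝ).symm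

@[simp] theorem planeEquiv_apply_zero (q : ℝ × ℝ) : planeEquiv q 0 = q.1 := rfl

@[simp] theorem planeEquiv_apply_one (q : ℝ × ℝ) : planeEquiv q 1 = q.2 := rfl

theorem planeEquiv_symm_apply (v : Plane) : planeEquiv.symm v = (v 0, v 1) := rfl

theorem planeEquiv_one_zero : planeEquiv (1, 0) = EuclideanSpace.single 0 1 := by
  ext i; fin_cases i <;> simp

theorem planeEquiv_zero_one : planeEquiv (0, 1) = EuclideanSpace.single 1 1 := by
  ext i; fin_cases i <;> simp

theorem measurePreserving_planeEquiv :
    MeasurePreserving (planeEquiv : ℝ × ℝ → Plane) volume volume :=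
  (PiLp.volume_preserving_toLp (Fin 2)).comp (volume_preserving_finTwoArrow ℝ).symm

theorem integral_comp_planeEquiv (f : Plane → ℝ) :
    ∫ q, f (planeEquiv q) = ∫ x, f x :=
  measurePreserving_planeEquiv.integral_comp
    planeEquiv.toHomeomorph.measurableEmbedding f

/-- Derivatives along vector fields are compatible with linear changes of coordinates. -/
theorem derivAlong_comp_equiv_iff {G G' E : Type*} [NormedAddCommGroup G] [NormedSpace ℝ G]
    [NormedAddCommGroup G'] [NormedSpace ℝ G'] [NormedAddCommGroup E] [NormedSpace ℝ E]
    (e : G ≃L[ℝ] G') {X : G' → G'} {h : G' → E} {k : E} {q : G} :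
    DerivAlong (fun q => e.symm (X (e q))) (fun q => h (e q)) k q ↔ DerivAlong X h k (e q) := by
  constructor
  · intro H γ h0 hγ
    have := H (fun t => e.symm (γ t)) (by simp [h0]) (by
      filter_upwards [hγ] with t ht
      simpa [Function.comp_def] using e.symm.toContinuousLinearMap.hasFDerivAt.comp_hasDerivAt t ht)
    simpa using this
  · intro H γ h0 hγ
    exact H (fun t => e (γ t)) (by simp [h0]) (by
      filter_upwards [hγ] with t ht
      simpa [Function.comp_def] using e.toContinuousLinearMap.hasFDerivAt.comp_hasDerivAt t ht)

section Regularity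

variable {Ω : Set Plane} {u : Plane → ℝ} {F : Plane → Plane}

theorem continuousOn_gradient (hΩ : IsOpen Ω) (hu : ContDiffOn ℝ 1 u Ω) :
    ContinuousOn (∇ u) Ω :=
  (InnerProductSpace.toDual ℝ Plane).symm.continuous.comp_continuousOn
    (hu.continuousOn_fderiv_of_isOpen hΩ le_rfl)

theorem continuousOn_areaElement (hΩ : IsOpen Ω) (hu : ContDiffOn ℝ 1 u Ω)
    (hF : ContDiffOn ℝ 1 F Ω) : ContinuousOn (areaElement u F) Ω :=
  ((continuousOn_gradient hΩ hu).add hF.continuousOn).norm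

theorem continuousOn_horizontalNormal (hΩ : IsOpen Ω) (hu : ContDiffOn ℝ 1 u Ω)
    (hF : ContDiffOn ℝ 1 F Ω) (hns : ∀ p ∈ Ω, ∇ u p + F p ≠ 0) :
    ContinuousOn (horizontalNormal u F) Ω :=
  ((continuousOn_areaElement hΩ hu hF).inv₀ fun p hp => norm_ne_zero_iff.2 (hns p hp)).smul
    ((continuousOn_gradient hΩ hu).add hF.continuousOn)

theorem continuousOn_curl (hΩ : IsOpen Ω) (hF : ContDiffOn ℝ 1 F Ω) : ContinuousOn (curl F) Ω := by
  have h := hF.continuousOn_fderiv_of_isOpen hΩ le_rfl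
  have h' : ∀ (i : Fin 2) (v : Plane), ContinuousOn (fun p => fderiv ℝ F p v i) Ω := fun i v =>
    (EuclideanSpace.proj i : Plane →L[ℝ] ℝ).continuous.comp_continuousOn
      (h.clm_apply continuousOn_const)
  exact (h' 1 _).sub (h' 0 _)

theorem horizontalNormal_sq_add_sq {p : Plane} (hp : ∇ u p + F p ≠ 0) :
    horizontalNormal u F p 0 ^ 2 + horizontalNormal u F p 1 ^ 2 = 1 := by
  have h : ‖horizontalNormal u F p‖ = 1 := by
    rw [horizontalNormal, areaElement, norm_smul, norm_inv, norm_norm,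
      inv_mul_cancel₀ (norm_ne_zero_iff.2 hp)]
  rw [EuclideanSpace.norm_eq, Real.sqrt_eq_one, Fin.sum_univ_two] at h
  simpa using h

theorem areaElement_mul_horizontalNormal {p : Plane} (hp : ∇ u p + F p ≠ 0) (i : Fin 2) :
    areaElement u F p * horizontalNormal u F p i = (∇ u p) i + F p i := by
  have : areaElement u F p ≠ 0 := norm_ne_zero_iff.2 hp
  simp only [horizontalNormal, PiLp.smul_apply, PiLp.add_apply, smul_eq_mul]
  field_simp

theorem hasFDerivAt_comp_planeEquiv {f : Plane → ℝ} {q : ℝ × ℝ}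
    (hf : DifferentiableAt ℝ f (planeEquiv q)) :
    HasFDerivAt (fun q => f (planeEquiv q))
      ((fderiv ℝ f (planeEquiv q)).comp (planeEquiv : ℝ × ℝ →L[ℝ] Plane)) q :=
  hf.hasFDerivAt.comp q planeEquiv.toContinuousLinearMap.hasFDerivAt

theorem gradient_apply_zero (f : Plane → ℝ) (p : Plane) :
    (∇ f p) 0 = fderiv ℝ f p (planeEquiv (1, 0)) := by
  rw [← inner_gradient_left, planeEquiv_one_zero, EuclideanSpace.inner_single_right]
  simp

theorem gradient_apply_one (f : Plane → ℝ) (p : Plane) :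
    (∇ f p) 1 = fderiv ℝ f p (planeEquiv (0, 1)) := by
  rw [← inner_gradient_left, planeEquiv_zero_one, EuclideanSpace.inner_single_right]
  simp

/-- The curl of `D N = ∇u + F` is `curl F`, although `∇u` is only continuous. -/
theorem hasCirculation_areaElement_mul_normal (hΩ : IsOpen Ω) (hu : ContDiffOn ℝ 1 u Ω)
    (hF : ContDiffOn ℝ 1 F Ω) (hns : ∀ p ∈ Ω, ∇ u p + F p ≠ 0) {S : Set (ℝ × ℝ)}
    (hS : MapsTo planeEquiv S Ω) :
    HasCirculation
      (fun q => areaElement u F (planeEquiv q) * horizontalNormal u F (planeEquiv q) 0)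
      (fun q => areaElement u F (planeEquiv q) * horizontalNormal u F (planeEquiv q) 1)
      (fun q => curl F (planeEquiv q)) S := by
  have hFd : ∀ q ∈ S, ∀ i : Fin 2, HasFDerivAt (fun q => F (planeEquiv q) i)
      ((EuclideanSpace.proj i : Plane →L[ℝ] ℝ).comp
        ((fderiv ℝ F (planeEquiv q)).comp (planeEquiv : ℝ × ℝ →L[ℝ] Plane))) q := fun q hq i =>
    (EuclideanSpace.proj i : Plane →L[ℝ] ℝ).hasFDerivAt.comp q
      ((((hF.contDiffAt (hΩ.mem_nhds (hS hq))).differentiableAt one_ne_zero).hasFDerivAt).comp q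
        planeEquiv.toContinuousLinearMap.hasFDerivAt)
  have hFc : ∀ i : Fin 2, ContinuousOn (fun q => F (planeEquiv q) i) S := fun i q hq =>
    (hFd q hq i).continuousAt.continuousWithinAt
  have hcurl : HasCirculation (fun q => F (planeEquiv q) 0) (fun q => F (planeEquiv q) 1)
      (fun q => curl F (planeEquiv q)) S :=
    hasCirculation_of_hasFDerivAt (hFc 0) (hFc 1)
      ((continuousOn_curl hΩ hF).comp planeEquiv.continuous.continuousOn hS)
      (fun q hq => hFd q hq 0) (fun q hq => hFd q hq 1) (fun q hq => by
        simp [curl, planeEquiv_one_zero, planeEquiv_zero_one])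
  refine (hcurl.add_gradient (hFc 0) (hFc 1) (fun q hq => hasFDerivAt_comp_planeEquiv
    ((hu.contDiffAt (hΩ.mem_nhds (hS hq))).differentiableAt one_ne_zero)) ?_).congr
    (fun q hq => ?_) (fun q hq => ?_) (fun q hq => rfl)
  · exact ((hu.continuousOn_fderiv_of_isOpen hΩ le_rfl).comp
      planeEquiv.continuous.continuousOn hS).clm_comp continuousOn_const
  · simp only [areaElement_mul_horizontalNormal (hns _ (hS hq)), gradient_apply_zero]
    rfl
  · simp only [areaElement_mul_horizontalNormal (hns _ (hS hq)), gradient_apply_one]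
    rfl

end Regularity

theorem inner_gradient_comp_planeEquiv_symm {φ : ℝ × ℝ → ℝ} {q : ℝ × ℝ}
    (hφ : DifferentiableAt ℝ φ q) (v : Plane) :
    ⟪v, ∇ (fun x => φ (planeEquiv.symm x)) (planeEquiv q)⟫_ℝ =
      v 0 * fderiv ℝ φ q (1, 0) + v 1 * fderiv ℝ φ q (0, 1) := by
  have h : HasFDerivAt (fun x => φ (planeEquiv.symm x))
      ((fderiv ℝ φ q).comp (planeEquiv.symm : Plane →L[ℝ] ℝ × ℝ)) (planeEquiv q) := by
    have := hφ.hasFDerivAt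
    rw [← planeEquiv.symm_apply_apply q] at this
    have h2 := this.comp (planeEquiv q) planeEquiv.symm.toContinuousLinearMap.hasFDerivAt
    rwa [planeEquiv.symm_apply_apply] at h2
  have hv : (v 0, v 1) = v 0 • ((1, 0) : ℝ × ℝ) + v 1 • ((0, 1) : ℝ × ℝ) := by simp
  rw [real_inner_comm, inner_gradient_left, h.fderiv, ContinuousLinearMap.comp_apply,
    ContinuousLinearEquiv.coe_coe, planeEquiv_symm_apply, hv, map_add, map_smul, map_smul,
    smul_eq_mul, smul_eq_mul]

/-- Without singular points, testing with `φ` and `-φ` turns the weak inequality into the weak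
divergence equation, here in the coordinates of `ℝ × ℝ` and with continuous extensions of the
coefficients from a square to the whole plane. -/
theorem IsWeakSolution.integral_eq_zero {Ω : Set Plane} {u : Plane → ℝ} {F : Plane → Plane}
    {H : Plane → ℝ} (hsol : IsWeakSolution Ω u F H) (hns : ∀ p ∈ Ω, ∇ u p + F p ≠ 0)
    {S : Set (ℝ × ℝ)} (hS : MapsTo planeEquiv S Ω) {n₁ n₂ h : ℝ × ℝ → ℝ}
    (h₁ : Continuous n₁) (h₂ : Continuous n₂) (hh : Continuous h)
    (e₁ : ∀ q ∈ S, n₁ q = horizontalNormal u F (planeEquiv q) 0)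
    (e₂ : ∀ q ∈ S, n₂ q = horizontalNormal u F (planeEquiv q) 1)
    (e₃ : ∀ q ∈ S, h q = H (planeEquiv q))
    {φ : ℝ × ℝ → ℝ} (hφ : ContDiff ℝ ∞ φ) (hφc : HasCompactSupport φ) (hφS : tsupport φ ⊆ S) :
    ∫ q, n₁ q * fderiv ℝ φ q (1, 0) + n₂ q * fderiv ℝ φ q (0, 1) + h q * φ q = 0 := by
  have hsing : singularSet Ω u F = ∅ := by
    ext x
    simp only [singularSet, mem_ofPred_eq, mem_empty_iff_false, iff_false, not_and]
    exact hns x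
  have key : ∀ ψ : ℝ × ℝ → ℝ, ContDiff ℝ ∞ ψ → HasCompactSupport ψ → tsupport ψ ⊆ S →
      0 ≤ ∫ q, n₁ q * fderiv ℝ ψ q (1, 0) + n₂ q * fderiv ℝ ψ q (0, 1) + h q * ψ q := by
    intro ψ hψ hψc hψS
    have hout : ∀ q, q ∉ S → ψ q = 0 ∧ fderiv ℝ ψ q = 0 := fun q hq =>
      ⟨image_eq_zero_of_notMem_tsupport fun hq' => hq (hψS hq'),
        fderiv_of_notMem_tsupport ℝ fun hq' => hq (hψS hq')⟩
    have hdψ : ∀ q, DifferentiableAt ℝ ψ q := fun q => hψ.differentiable (by simp) q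
    set ψ' : Plane → ℝ := fun x => ψ (planeEquiv.symm x) with hψ'
    have hts : tsupport ψ' = planeEquiv.symm ⁻¹' tsupport ψ :=
      tsupport_comp_eq_preimage ψ planeEquiv.symm.toHomeomorph
    have hw := hsol ψ' (hψ.comp planeEquiv.symm.contDiff)
      (hψc.comp_homeomorph planeEquiv.symm.toHomeomorph) (fun x hx => by
        rw [hts] at hx
        simpa using hS (hψS hx))
    have hzero : ∀ x, x ∉ Ω → ψ' x = 0 ∧ ∇ ψ' x = 0 := fun x hx => by
      have hx' : x ∉ tsupport ψ' := fun h => hx (by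
        rw [hts] at h
        simpa using hS (hψS h))
      refine ⟨image_eq_zero_of_notMem_tsupport hx', ?_⟩
      rw [gradient, fderiv_of_notMem_tsupport ℝ hx', map_zero]
    rw [hsing, Measure.restrict_empty, integral_zero_measure, zero_add, sdiff_empty,
      setIntegral_eq_integral_of_forall_compl_eq_zero (fun x hx => by rw [(hzero x hx).2,
        inner_zero_right]),
      setIntegral_eq_integral_of_forall_compl_eq_zero (fun x hx => by rw [(hzero x hx).1,
        mul_zero]), ← integral_comp_planeEquiv, ← integral_comp_planeEquiv] at hw
    have i₁ : ∀ q, ⟪horizontalNormal u F (planeEquiv q), ∇ ψ' (planeEquiv q)⟫_ℝ =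
        n₁ q * fderiv ℝ ψ q (1, 0) + n₂ q * fderiv ℝ ψ q (0, 1) := fun q => by
      rw [inner_gradient_comp_planeEquiv_symm (hdψ q)]
      by_cases hq : q ∈ S
      · rw [e₁ q hq, e₂ q hq]
      · simp [(hout q hq).2]
    have i₂ : ∀ q, H (planeEquiv q) * ψ' (planeEquiv q) = h q * ψ q := fun q => by
      by_cases hq : q ∈ S
      · simp [hψ', e₃ q hq]
      · simp [hψ', (hout q hq).1]
    simp only [i₁, i₂] at hw
    have hfc : ∀ v, Continuous fun q => fderiv ℝ ψ q v := fun v =>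
      (hψ.continuous_fderiv (by simp)).clm_apply continuous_const
    have hfs : ∀ v, HasCompactSupport fun q => fderiv ℝ ψ q v := fun v =>
      hψc.fderiv_apply (𝕜 := ℝ) v
    rwa [← integral_add] at hw
    · exact (((h₁.mul (hfc _)).integrable_of_hasCompactSupport ((hfs _).mul_left)).add
        ((h₂.mul (hfc _)).integrable_of_hasCompactSupport ((hfs _).mul_left)))
    · exact (hh.mul hψ.continuous).integrable_of_hasCompactSupport hψc.mul_left
  refine le_antisymm ?_ (key φ hφ hφc hφS)
  have := key (fun q => -φ q) hφ.neg hφc.neg (by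
    rwa [show tsupport (fun q => -φ q) = tsupport φ from by
      simp [tsupport, Function.support_fun_neg]])
  have hd : ∀ q v, fderiv ℝ (fun q => -φ q) q v = -fderiv ℝ φ q v := fun q v => by
    rw [fderiv_fun_neg]; rfl
  simp only [hd] at this
  rw [← neg_nonneg, ← integral_neg]
  refine this.trans_eq (integral_congr_ae (.of_forall fun q => ?_))
  simp only
  ring

/-- The local form of the theorem: near every point, the derivatives exist and are continuous. The
field `N^⊥` also has an integral curve through every point. -/
theorem exists_local_second_derivAlong {Ω : Set Plane} (hΩ : IsOpen Ω) {u : Plane → ℝ}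
    {F : Plane → Plane} {H : Plane → ℝ} (hu : ContDiffOn ℝ 1 u Ω) (hF : ContDiffOn ℝ 1 F Ω)
    (hH : ContinuousOn H Ω) (hsol : IsWeakSolution Ω u F H) (hns : ∀ p ∈ Ω, ∇ u p + F p ≠ 0)
    {c' k : Plane → ℝ} (hc' : ∀ p ∈ Ω, HasDerivAlong (charDirection u F) (curl F) (c' p) p)
    (hc'c : ContinuousOn c' Ω) (hk : ∀ p ∈ Ω, HasDerivAlong (horizontalNormal u F) H (k p) p)
    (hkc : ContinuousOn k Ω) {p : Plane} (hp : p ∈ Ω) :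
    ∃ D₁ D₂ : Plane → ℝ, ∀ᶠ q in 𝓝 p, ContinuousAt D₁ q ∧ ContinuousAt D₂ q ∧
      HasDerivAlong (charDirection u F) (areaElement u F) (D₁ q) q ∧
      HasDerivAlong (charDirection u F) D₁ (D₂ q) q ∧
      areaElement u F q * D₂ q = 2 * (D₁ q - curl F q / 2) * (D₁ q - curl F q)
        + c' q * areaElement u F q + (H q ^ 2 + k q) * areaElement u F q ^ 2 ∧
      ∃ γ : ℝ → Plane, γ 0 = q ∧ IsIntegralCurveAt γ (fun _ => charDirection u F) 0 := by
  set P := planeEquiv.symm p with hP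
  have hPp : planeEquiv P = p := planeEquiv.apply_symm_apply p
  obtain ⟨R, hR, hRΩ⟩ := nhds_basis_closedBall.mem_iff.1
    (planeEquiv.continuous.continuousAt.preimage_mem_nhds (x := P)
      (by rw [hPp]; exact hΩ.mem_nhds hp))
  obtain ⟨ρ, hρ, hρm, hρid⟩ := exists_continuous_retraction_closedBall P hR.le
  -- clamping makes the coefficients continuous on the whole plane
  have hext : ∀ {h : Plane → ℝ}, ContinuousOn h Ω → Continuous fun q => h (planeEquiv (ρ q)) :=
    fun hh => hh.comp_continuous (planeEquiv.continuous.comp hρ) fun q => hRΩ (hρm q)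
  have hid : ∀ q ∈ ball P R, ρ q = q := fun q hq => hρid q (ball_subset_closedBall hq)
  have hΩm : MapsTo planeEquiv (ball P R) Ω := fun q hq => hRΩ (ball_subset_closedBall hq)
  have hNc := continuousOn_horizontalNormal hΩ hu hF hns
  have hNi : ∀ i : Fin 2, ContinuousOn (fun x => horizontalNormal u F x i) Ω := fun i =>
    (EuclideanSpace.proj i : Plane →L[ℝ] ℝ).continuous.comp_continuousOn hNc
  have hDc := continuousOn_areaElement hΩ hu hF
  have hcc := continuousOn_curl hΩ hF
  set n₁ : ℝ × ℝ → ℝ := fun q => horizontalNormal u F (planeEquiv (ρ q)) 0 with hn₁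
  set n₂ : ℝ × ℝ → ℝ := fun q => horizontalNormal u F (planeEquiv (ρ q)) 1 with hn₂
  have hc₁ : Continuous n₁ := hext (hNi 0)
  have hc₂ : Continuous n₂ := hext (hNi 1)
  have hR2 : R / 2 < R := by linarith
  have hsub : ball P (R / 2) ⊆ ball P R := ball_subset_ball hR2.le
  have hperp : ∀ q ∈ ball P R, (n₂ q, -n₁ q) = planeEquiv.symm (charDirection u F (planeEquiv q)) :=
    fun q hq => by
      simp only [hn₁, hn₂, hid q hq, planeEquiv_symm_apply]
      rfl
  have hnorm : ∀ q ∈ ball P R,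
      (n₁ q, n₂ q) = planeEquiv.symm (horizontalNormal u F (planeEquiv q)) := fun q hq => by
    simp only [hn₁, hn₂, hid q hq, planeEquiv_symm_apply]
  have hev : ∀ q ∈ ball P R, ∀ᶠ q' in 𝓝 q, q' ∈ ball P R := fun q hq => isOpen_ball.mem_nhds hq
  have hfun : ∀ h : Plane → ℝ, ∀ q ∈ ball P R,
      (fun q => h (planeEquiv (ρ q))) =ᶠ[𝓝 q] fun q => h (planeEquiv q) := fun h q hq => by
    filter_upwards [hev q hq] with q' hq'
    rw [hid q' hq']
  obtain ⟨D₁, D₂, hD⟩ := exists_second_derivAlong (p := P) (r := R / 2) hc₁ hc₂ (hext hDc)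
    (hext hcc) (hext hH) (hext hc'c) (hext hkc) (by positivity)
    (fun q hq => by
      simp only [hn₁, hn₂]
      exact horizontalNormal_sq_add_sq (hns _ (hRΩ (hρm q))))
    (fun q hq => norm_pos_iff.2 (hns _ (hRΩ (hρm q))))
    ((hasCirculation_areaElement_mul_normal hΩ hu hF hns (hΩm.mono_left hsub)).congr
      (fun q hq => by simp only [hn₁, hid q (hsub hq)])
      (fun q hq => by simp only [hn₂, hid q (hsub hq)])
      (fun q hq => by simp only [hid q (hsub hq)]))
    (hasCirculation_of_weak_divergence hc₁ hc₂ (hext hH) hR2 fun φ hφ hφc hφS =>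
      hsol.integral_eq_zero hns hΩm hc₁ hc₂ (hext hH)
        (fun q hq => by simp only [hn₁, hid q hq]) (fun q hq => by simp only [hn₂, hid q hq])
        (fun q hq => by simp only [hid q hq]) hφ hφc hφS)
    (fun q hq => by
      have hq := hsub hq
      simp only [hid q hq]
      exact ((derivAlong_comp_equiv_iff planeEquiv).2 (hc' _ (hΩm hq))).congr
        ((hev q hq).mono hperp) (hfun _ q hq))
    (fun q hq => by
      have hq := hsub hq
      simp only [hid q hq]
      exact ((derivAlong_comp_equiv_iff planeEquiv).2 (hk _ (hΩm hq))).congr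
        ((hev q hq).mono hnorm) (hfun _ q hq))
  have ht : Tendsto planeEquiv.symm (𝓝 p) (𝓝 P) := planeEquiv.symm.continuous.tendsto p
  refine ⟨fun x => D₁ (planeEquiv.symm x), fun x => D₂ (planeEquiv.symm x), ?_⟩
  filter_upwards [ht.eventually hD, ht.eventually (hev P (mem_ball_self hR))] with x hx hxb
  obtain ⟨x1, x2, x3, x4, x5, γ, hγ0, hγ⟩ := hx
  have hperp' : (fun q => planeEquiv.symm (charDirection u F (planeEquiv q)))
      =ᶠ[𝓝 (planeEquiv.symm x)] fun q => (n₂ q, -n₁ q) :=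
    (hev _ hxb).mono fun q hq => (hperp q hq).symm
  have hcont : ContinuousAt planeEquiv.symm x := planeEquiv.symm.continuous.continuousAt
  refine ⟨x1.comp hcont, x2.comp hcont, ?_, ?_, ?_, fun t => planeEquiv (γ t), by simp [hγ0], ?_⟩
  · have := (derivAlong_comp_equiv_iff planeEquiv).1
      (x3.congr hperp' (hfun (areaElement u F) _ hxb).symm)
    rwa [planeEquiv.apply_symm_apply] at this
  · have := (derivAlong_comp_equiv_iff (h := fun x => D₁ (planeEquiv.symm x)) planeEquiv).1
      (x4.congr hperp' (.of_forall fun q => by simp))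
    rwa [planeEquiv.apply_symm_apply] at this
  · simpa only [hid _ hxb, planeEquiv.apply_symm_apply] using x5
  · have hγt : Tendsto γ (𝓝 0) (𝓝 (planeEquiv.symm x)) :=
      hγ0 ▸ hγ.self_of_nhds.continuousAt.tendsto
    filter_upwards [hγ, hγt.eventually (hev _ hxb)] with t h1 h2
    refine (planeEquiv.toContinuousLinearMap.hasFDerivAt.comp_hasDerivAt t h1).congr_deriv ?_
    rw [hperp _ h2]
    simp

end PrescribedMean

open PrescribedMean
theorem theoremA
    (Ω : Set Plane) (hΩ : IsOpen Ω) (hΩc : IsConnected Ω)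
    (u : Plane → ℝ) (F : Plane → Plane) (H : Plane → ℝ)
    (hu : ContDiffOn ℝ 1 u Ω) (hF : ContDiffOn ℝ 1 F Ω) (hH : ContinuousOn H Ω)
    (hsol : IsWeakSolution Ω u F H)
    (hns : ∀ p ∈ Ω, ∇ u p + F p ≠ 0)
    -- `c' = N^⊥(curl F)` exists and is continuous in `Ω`
    (c' : Plane → ℝ)
    (hc' : ∀ p ∈ Ω, HasDerivAlong (charDirection u F) (curl F) (c' p) p)
    (hc'_cont : ContinuousOn c' Ω)
    -- `NH = N(H)` exists and is continuous in `Ω`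
    (NH : Plane → ℝ)
    (hNH : ∀ p ∈ Ω, HasDerivAlong (horizontalNormal u F) H (NH p) p)
    (hNH_cont : ContinuousOn NH Ω) :
    ∃ D' D'' : Plane → ℝ,
      (∀ p ∈ Ω, HasDerivAlong (charDirection u F) (areaElement u F) (D' p) p) ∧
      ContinuousOn D' Ω ∧
      (∀ p ∈ Ω, HasDerivAlong (charDirection u F) D' (D'' p) p) ∧
      ContinuousOn D'' Ω ∧
      ∀ p ∈ Ω,
        areaElement u F p * D'' p =
          2 * (D' p - curl F p / 2) * (D' p - curl F p)
            + c' p * areaElement u F p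
            + (H p ^ 2 + NH p) * areaElement u F p ^ 2 := by
  classical
  have loc := fun (p : Plane) (hp : p ∈ Ω) => exists_local_second_derivAlong hΩ hu hF hH hsol hns
    hc' hc'_cont hNH hNH_cont hp
  choose D₁ D₂ hD using loc
  set D' : Plane → ℝ := fun p => if hp : p ∈ Ω then D₁ p hp p else 0 with hD'
  set D'' : Plane → ℝ := fun p => if hp : p ∈ Ω then D₂ p hp p else 0 with hD''
  -- integral curves exist, so that the derivatives are unique and the local solutions agree
  have e₁ : ∀ p hp, ∀ᶠ q in 𝓝 p, D' q = D₁ p hp q := fun p hp => by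
    filter_upwards [hD p hp, hΩ.mem_nhds hp] with q hq hqΩ
    obtain ⟨-, -, h1, -, -, γ, hγ0, hγ⟩ := hq
    have h2 := (hD q hqΩ).self_of_nhds.2.2.1
    simp only [hD', dif_pos hqΩ]
    exact DerivAlong.unique h2 h1 hγ0 hγ
  have e₂ : ∀ p hp, ∀ᶠ q in 𝓝 p, D'' q = D₂ p hp q := fun p hp => by
    filter_upwards [hD p hp, hΩ.mem_nhds hp, (e₁ p hp).eventually_nhds] with q hq hqΩ hqe
    obtain ⟨-, -, -, h1, -, γ, hγ0, hγ⟩ := hq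
    have h2 := (hD q hqΩ).self_of_nhds.2.2.2.1
    have h3 : D₁ q hqΩ =ᶠ[𝓝 q] D₁ p hp := by
      filter_upwards [hqe, e₁ q hqΩ] with q' h4 h5
      rw [← h4, h5]
    have h1' := DerivAlong.congr h1 Filter.EventuallyEq.rfl h3
    simp only [hD'', dif_pos hqΩ]
    exact DerivAlong.unique h2 h1' hγ0 hγ
  refine ⟨D', D'', fun p hp => ?_, fun p hp => ?_, fun p hp => ?_, fun p hp => ?_, fun p hp => ?_⟩
  · rw [(e₁ p hp).self_of_nhds]
    exact (hD p hp).self_of_nhds.2.2.1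
  · exact ((hD p hp).self_of_nhds.1.congr (Filter.EventuallyEq.symm (e₁ p hp))).continuousWithinAt
  · rw [(e₂ p hp).self_of_nhds]
    exact DerivAlong.congr (hD p hp).self_of_nhds.2.2.2.1 Filter.EventuallyEq.rfl (e₁ p hp)
  · exact ((hD p hp).self_of_nhds.2.1.congr (Filter.EventuallyEq.symm (e₂ p hp))).continuousWithinAt
  · rw [(e₁ p hp).self_of_nhds, (e₂ p hp).self_of_nhds]
    exact (hD p hp).self_of_nhds.2.2.2.2.1
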